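/- Let $0<p\le 1$, let $\mathbb F\in\{\mathbb R,\mathbb C\}$ and let $\mathbb X$ be a $p$-Banach space over $\mathbb F$, i.e. a vector space, complete for a function $\|\cdot\|$ satisfying $\|x\|\ge 0$ with equality only for $x=0$, $\|\lambda x\|=|\lambda|\|x\|$ and $\|x+y\|^p\le\|x\|^p+\|y\|^p$. Let $\mathcal B=(e_n)_{n\in\mathbb N}$ be a basis of $\mathbb X$: the span of $\mathcal B$ is dense in $\mathbb X$, there are (necessarily unique) functionals $e_n^*\in\mathbb X^*$ with $e_j^*(e_k)=\delta_{j,k}$, and $0<\inf_n\{\|e_n\|,\|e_n^*\|\}\le\sup_n\{\|e_n\|,\|e_n^*\|\}<\infty$. The basis $\mathcal B$ is a Markushevich basis if in addition the span of $(e_n^*)_n$ is weak$^*$-dense in $\mathbb X^*$, and a Schauder basis if there is $C>0$ with $\|\sum_{n=1}^m e_n^*(x)e_n\|\le C\|x\|$ for all $x\in\mathbb X$ and $m\in\mathbb N$. Notation. $\operatorname{supp}(x)=\{n: e_n^*(x)\ne0\}$; $\mathcal E$ is the set of sequences $(\varepsilon_n)_n$ of scalars with $|\varepsilon_n|=1$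 for all $n$; for a finite $A\subset\mathbb N$ and $\varepsilon\in\mathcal E$, $\mathbf 1_{\varepsilon,A}=\sum_{n\in A}\varepsilon_ne_n$ and $\mathbf 1_A=\sum_{n\in A}e_n$; $G(x)$ is the set of finite greedy sets of $x$, i.e. of the finite $A\subset\mathbb N$ with $|e_n^*(x)|\ge|e_k^*(x)|$ for all $n\in A$, $k\notin A$. A basis $(y_n)_n$ of a quasi-Banach space is symmetric if there is $C>0$ with $\|\sum_n\varepsilon_na_ny_{\sigma(n)}\|\le C\|\sum_na_ny_n\|$ for all finitely supported scalar sequences $(a_n)_n$, all $\varepsilon\in\mathcal E$ and all permutations $\sigma$ of $\mathbb N$; its fundamental function is $\varphi(m)=\sup_{|A|\le m}\|\sum_{n\in A}y_n\|$. A basis $(y_n)_n$ dominates $(z_n)_n$ if there is $C>0$ with $\|\sum_na_nz_n\|\le C\|\sum_na_ny_n\|$ for all finitely supported $(a_n)_n$. The basis $\mathcal B$ is squeeze symmetric if there are symmetric bases $\mathcal S$ and $\mathcal T$ of quasi-Banach spaces such that $\mathcal S$ dominates $\mathcal B$, $\mathcal B$ dominates $\mathcal T$, and the fundamental functions of $\mathcal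 S$ and $\mathcal T$ are equivalent, i.e. each is bounded by a constant multiple of the other. (Here the quasi-norms are $r$-norms with $r\in(0,1]$ depending on the space; by the Aoki–Rolewicz theorem this is no restriction.) Consider the following statements. (i) $\mathcal B$ is squeeze symmetric. (ii) There is $C>0$ such that $\|x+\lambda\mathbf 1_{\varepsilon,A}\|\le C\|x+\lambda\mathbf 1_{\delta,B}\|$ for all $x\in\mathbb X$, all $A\in G(x)$, all finite $B\subset\mathbb N$ with $|B|\ge|A|$ and $|B\cap\operatorname{supp}(x)|\le|A|$, all $\varepsilon,\delta\in\mathcal E$ with $\varepsilon_n=\delta_n$ for all $n\in A\cap B$, and all $\lambda\in\mathbb F$. (iii) There is $C>0$ such that $\|x-\mathbf 1_A\|\le C\|x-\mathbf 1_{\varepsilon,B}\|$ for all $x\in\mathbb X$, all $A\in G(x)$, all $B\subset\operatorname{supp}(x)$ with $|B|=|A|$ and $A\cap B=\emptyset$, and all $\varepsilon\in\mathcal E$. Then (i) implies (ii), and (ii) implies (iii). Moreover, if $p=1$ and $\mathcal B$ is a Markushevich basis, or if $0<p\le1$ and $\mathcal B$ is a Schauder basis, then (iii) implies (i). -/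

import Mathlib

universe u v w

/-- `X`, with the function `‖·‖`, is a `p`-Banach space over `𝕜`, where `0 < p ≤ 1`.
The type class `Norm X` only provides the notation `‖·‖`; all laws are listed here. -/
structure IsPBanach (p : ℝ) (𝕜 : Type v) (X : Type u) [RCLike 𝕜] [AddCommGroup X] [Module 𝕜 X]
    [Norm X] : Prop where
  p_pos : 0 < p
  p_le_one : p ≤ 1
  nonneg : ∀ x : X, 0 ≤ ‖x‖
  eq_zero_iff : ∀ x : X, ‖x‖ = 0 ↔ x = 0
  smul : ∀ (c : 𝕜) (x : X), ‖c • x‖ = ‖c‖ * ‖x‖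
  add_rpow_le : ∀ x y : X, ‖x + y‖ ^ p ≤ ‖x‖ ^ p + ‖y‖ ^ p
  complete : ∀ s : ℕ → X,
    (∀ η : ℝ, 0 < η → ∃ N : ℕ, ∀ m n : ℕ, N ≤ m → N ≤ n → ‖s m - s n‖ < η) →
      ∃ x : X, ∀ η : ℝ, 0 < η → ∃ N : ℕ, ∀ n : ℕ, N ≤ n → ‖s n - x‖ < η

section Bases

variable {𝕜 : Type v} {X : Type u} {Y : Type w} [RCLike 𝕜]
  [AddCommGroup X] [Module 𝕜 X] [Norm X] [AddCommGroup Y] [Module 𝕜 Y] [Norm Y]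

/-- The linear functional `f` belongs to the dual space of `X`. -/
def IsBoundedFunctional (f : X →ₗ[𝕜] 𝕜) : Prop :=
  ∃ C : ℝ, ∀ x : X, ‖f x‖ ≤ C * ‖x‖

/-- The norm of a bounded linear functional, `sup {|f x| : ‖x‖ ≤ 1}`. -/
noncomputable def functionalNorm (f : X →ₗ[𝕜] 𝕜) : ℝ :=
  sSup {t : ℝ | ∃ x : X, ‖x‖ ≤ 1 ∧ t = ‖f x‖}

/-- `e` is a basis of `X` with coordinate functionals `e'`: the span of `e` is dense, the
functionals `e'` are bounded and biorthogonal to `e`, and the norms of the `e n` and of the `e' n`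
are bounded and bounded away from zero. By density of the span, `e` determines `e'`
(see `IsBasis.unique`). -/
structure IsBasis (e : ℕ → X) (e' : ℕ → (X →ₗ[𝕜] 𝕜)) : Prop where
  dense : ∀ (x : X) (η : ℝ), 0 < η → ∃ y ∈ Submodule.span 𝕜 (Set.range e), ‖x - y‖ < η
  bounded : ∀ n : ℕ, IsBoundedFunctional (e' n)
  biorthogonal : ∀ j k : ℕ, e' j (e k) = if j = k then 1 else 0
  seminormalized : ∃ c₁ c₂ : ℝ, 0 < c₁ ∧ ∀ n : ℕ,
    c₁ ≤ ‖e n‖ ∧ ‖e n‖ ≤ c₂ ∧ c₁ ≤ functionalNorm (e' n) ∧ functionalNorm (e' n) ≤ c₂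

theorem IsBasis.unique {p : ℝ} (hX : IsPBanach p 𝕜 X) {e : ℕ → X} {e' f : ℕ → (X →ₗ[𝕜] 𝕜)}
    (h : IsBasis e e') (hf : ∀ n, IsBoundedFunctional (f n))
    (hb : ∀ j k : ℕ, f j (e k) = if j = k then 1 else 0) : f = e' := by
  funext j
  obtain ⟨C, hC⟩ := hf j
  obtain ⟨D, hD⟩ := h.bounded j
  have hspan : ∀ y ∈ Submodule.span 𝕜 (Set.range e), f j y = e' j y := by
    intro y hy
    induction hy using Submodule.span_induction with
    | mem y hy =>
      obtain ⟨k, rfl⟩ := hy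
      rw [hb, h.biorthogonal]
    | zero => simp
    | add a b _ _ ha hb' => simp [ha, hb']
    | smul c a _ ha => simp [ha]
  ext x
  by_contra hne
  have hpos : 0 < ‖f j x - e' j x‖ := norm_pos_iff.mpr (sub_ne_zero.mpr hne)
  have hK : 0 < |C| + |D| + 1 := by positivity
  obtain ⟨y, hy, hxy⟩ := h.dense x (‖f j x - e' j x‖ / (|C| + |D| + 1)) (by positivity)
  have h1 : f j x - e' j x = f j (x - y) - e' j (x - y) := by
    rw [map_sub, map_sub, hspan y hy]; ring
  have h2 : ‖f j x - e' j x‖ ≤ C * ‖x - y‖ + D * ‖x - y‖ := by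
    rw [h1]
    exact (norm_sub_le _ _).trans (add_le_add (hC _) (hD _))
  have h0 := hX.nonneg (x - y)
  rw [lt_div_iff₀ hK] at hxy
  nlinarith [le_abs_self C, le_abs_self D]

/-- A Markushevich basis: the span of the coordinate functionals is weak-star dense in the dual
space, that is, every bounded functional can be approximated by elements of this span on
every finite set of vectors. -/
structure IsMarkushevichBasis (e : ℕ → X) (e' : ℕ → (X →ₗ[𝕜] 𝕜)) : Prop
    extends IsBasis e e' where
  weakStarDense : ∀ f : X →ₗ[𝕜] 𝕜, IsBoundedFunctional f →
    ∀ (F : Finset X) (η : ℝ), 0 < η →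
      ∃ g ∈ Submodule.span 𝕜 (Set.range e'), ∀ x ∈ F, ‖f x - g x‖ < η

/-- A Schauder basis: the partial sum operators are uniformly bounded. -/
structure IsSchauderBasis (e : ℕ → X) (e' : ℕ → (X →ₗ[𝕜] 𝕜)) : Prop
    extends IsBasis e e' where
  partialSums : ∃ C : ℝ, 0 < C ∧
    ∀ (x : X) (m : ℕ), ‖∑ n ∈ Finset.range m, e' n x • e n‖ ≤ C * ‖x‖

/-- A sequence of signs: scalars of modulus one. -/
def IsSign (ε : ℕ → 𝕜) : Prop := ∀ n : ℕ, ‖ε n‖ = 1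

/-- The vector `1_{ε, A} = ∑_{n ∈ A} ε_n e_n`. -/
def signedIndicator (e : ℕ → X) (ε : ℕ → 𝕜) (A : Finset ℕ) : X := ∑ n ∈ A, ε n • e n

/-- The vector `1_A = ∑_{n ∈ A} e_n`. -/
def indicatorVec (e : ℕ → X) (A : Finset ℕ) : X := ∑ n ∈ A, e n

/-- The support of `x` with respect to the basis. -/
def basisSupport (e' : ℕ → (X →ₗ[𝕜] 𝕜)) (x : X) : Set ℕ := {n : ℕ | e' n x ≠ 0}

/-- The finite set `A` is a greedy set of `x`. -/
def IsGreedySet (e' : ℕ → (X →ₗ[𝕜] 𝕜)) (x : X) (A : Finset ℕ) : Prop :=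
  ∀ n ∈ A, ∀ k ∉ A, ‖e' k x‖ ≤ ‖e' n x‖

variable (𝕜) in
/-- The sequence `e` is symmetric: changes of signs and permutations are uniformly bounded. -/
def IsSymmetricSeq (e : ℕ → X) : Prop :=
  ∃ C : ℝ, 0 < C ∧ ∀ (σ : Equiv.Perm ℕ) (ε : ℕ → 𝕜), IsSign ε → ∀ a : ℕ →₀ 𝕜,
    ‖∑ n ∈ a.support, (ε n * a n) • e (σ n)‖ ≤ C * ‖Finsupp.linearCombination 𝕜 e a‖

variable (𝕜) in
/-- The sequence `f` dominates the sequence `e`. -/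
def Dominates (f : ℕ → Y) (e : ℕ → X) : Prop :=
  ∃ C : ℝ, 0 < C ∧ ∀ a : ℕ →₀ 𝕜,
    ‖Finsupp.linearCombination 𝕜 e a‖ ≤ C * ‖Finsupp.linearCombination 𝕜 f a‖

/-- The fundamental function `φ(m) = sup {‖1_A‖ : |A| ≤ m}`. -/
noncomputable def fundamentalFunction (e : ℕ → X) (m : ℕ) : ℝ :=
  sSup {t : ℝ | ∃ A : Finset ℕ, A.card ≤ m ∧ t = ‖indicatorVec e A‖}

end Bases

/-- A quasi-Banach space over `𝕜` with a symmetric basis. The quasi-norm is taken to be an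
`r`-norm for some `r ∈ (0, 1]`, which by the Aoki--Rolewicz theorem is no restriction up to
equivalence. A space with a basis is separable, so `Type v` is large enough. -/
structure SymmetricBasis (𝕜 : Type v) [RCLike 𝕜] where
  space : Type v
  [addCommGroup : AddCommGroup space]
  [module : Module 𝕜 space]
  [norm : Norm space]
  r : ℝ
  isPBanach : IsPBanach r 𝕜 space
  vec : ℕ → space
  coord : ℕ → (space →ₗ[𝕜] 𝕜)
  isBasis : IsBasis vec coord
  isSymmetric : IsSymmetricSeq 𝕜 vec

attribute [instance] SymmetricBasis.addCommGroup SymmetricBasis.module SymmetricBasis.norm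

section Properties

variable (𝕜 : Type v) {X : Type u} [RCLike 𝕜] [AddCommGroup X] [Module 𝕜 X] [Norm X]

/-- The basis `e` is squeeze symmetric: it is sandwiched between two symmetric bases of
quasi-Banach spaces whose fundamental functions are equivalent. -/
def IsSqueezeSymmetric (e : ℕ → X) : Prop :=
  ∃ S T : SymmetricBasis 𝕜,
    Dominates 𝕜 S.vec e ∧ Dominates 𝕜 e T.vec ∧
    ∃ C : ℝ, 0 < C ∧ ∀ m : ℕ,
      fundamentalFunction S.vec m ≤ C * fundamentalFunction T.vec m ∧
      fundamentalFunction T.vec m ≤ C * fundamentalFunction S.vec m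

variable {𝕜}

/-- `‖x + λ 1_{ε,A}‖ ≤ C ‖x + λ 1_{δ,B}‖` for all greedy sets `A` of `x` and all finite `B` with
`|B| ≥ |A|` and `|B ∩ supp x| ≤ |A|`, whenever the signs agree on `A ∩ B`. -/
def OneDimApprox (e : ℕ → X) (e' : ℕ → (X →ₗ[𝕜] 𝕜)) : Prop :=
  ∃ C : ℝ, 0 < C ∧ ∀ (x : X) (A B : Finset ℕ), IsGreedySet e' x A →
    A.card ≤ B.card → ((B : Set ℕ) ∩ basisSupport e' x).ncard ≤ A.card →
    ∀ ε δ : ℕ → 𝕜, IsSign ε → IsSign δ → (∀ n ∈ A ∩ B, ε n = δ n) → ∀ lam : 𝕜,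
      ‖x + lam • signedIndicator e ε A‖ ≤ C * ‖x + lam • signedIndicator e δ B‖

/-- `‖x - 1_A‖ ≤ C ‖x - 1_{ε,B}‖` for all greedy sets `A` of `x` and all `B ⊆ supp x` disjoint
from `A` with `|B| = |A|`. -/
def DisjointOneDimApprox (e : ℕ → X) (e' : ℕ → (X →ₗ[𝕜] 𝕜)) : Prop :=
  ∃ C : ℝ, 0 < C ∧ ∀ (x : X) (A B : Finset ℕ), IsGreedySet e' x A →
    (B : Set ℕ) ⊆ basisSupport e' x → B.card = A.card → Disjoint A B →
    ∀ ε : ℕ → 𝕜, IsSign ε →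
      ‖x - indicatorVec e A‖ ≤ C * ‖x - signedIndicator e ε B‖

end Properties

/-! All three conditions are compared with `LargeCoefficientEstimate`: if a vector has at least |A|
coefficients of modulus at least t, then its norm dominates t‖1_{ε,A}‖ up to a constant, for all
signs ε and wherever A lies.

Squeeze symmetry gives the estimate: the norm of 1_{ε,A} is controlled by the fundamental function
of the upper basis, hence by that of the lower one, and in a symmetric basis large coefficients can
be levelled to t and permuted. The estimate gives (ii), because x + λ1_{δ,B} always has enough
coefficients of modulus at least |λ|/2 to absorb the parts of 1_{ε,A} and 1_{δ,B} that differ.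
Condition (iii) is the case λ = -1 of (ii) for disjoint sets.

From (iii) the estimate comes back by polarization: adding to a vector fresh signed unit vectors, in
two ways with opposite signs on A, and subtracting the two instances of (iii) isolates 2·1_{ε,A}. A
fresh intermediate set removes the disjointness restriction.

Finally the estimate yields both symmetric bases. The upper one comes from the supremum of the norm
over permutations and signs. The lower one is of Lorentz type, built from averages of |a_n|^(p/2);
the estimate is a weak-type bound, and passing to the exponent p/2 makes it summable
(`sum_le_of_weak_bound`). Both fundamental functions are comparable with `signedFundamental` to the
power 1/p. -/

namespace IsPBanach

variable {p : ℝ} {𝕜 : Type v} {X : Type u} [RCLike 𝕜] [AddCommGroup X] [Module 𝕜 X] [Norm X]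

theorem norm_zero (hX : IsPBanach p 𝕜 X) : ‖(0 : X)‖ = 0 := (hX.eq_zero_iff 0).2 rfl

theorem norm_neg (hX : IsPBanach p 𝕜 X) (x : X) : ‖-x‖ = ‖x‖ := by
  have h := hX.smul (-1) x
  simpa using h

theorem sum_rpow_le (hX : IsPBanach p 𝕜 X) {ι : Type*} (s : Finset ι) (f : ι → X) :
    ‖∑ i ∈ s, f i‖ ^ p ≤ ∑ i ∈ s, ‖f i‖ ^ p := by
  classical
  induction s using Finset.induction_on with
  | empty => simp [hX.norm_zero, Real.zero_rpow hX.p_pos.ne']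
  | insert i s hi ih =>
    rw [Finset.sum_insert hi, Finset.sum_insert hi]
    exact (hX.add_rpow_le _ _).trans (by gcongr)

theorem smul_rpow (hX : IsPBanach p 𝕜 X) (c : 𝕜) (x : X) :
    ‖c • x‖ ^ p = ‖c‖ ^ p * ‖x‖ ^ p := by
  rw [hX.smul, Real.mul_rpow (_root_.norm_nonneg c) (hX.nonneg x)]

theorem norm_add_le_of_le (hX : IsPBanach p 𝕜 X) {x y : X} {a : ℝ}
    (hx : ‖x‖ ≤ a) (hy : ‖y‖ ≤ a) : ‖x + y‖ ≤ 2 ^ (1 / p) * a := by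
  have ha : 0 ≤ a := (hX.nonneg x).trans hx
  have hp := hX.p_pos
  rw [← Real.rpow_le_rpow_iff (hX.nonneg _) (by positivity) hp,
    Real.mul_rpow (by positivity) ha, ← Real.rpow_mul (by norm_num), one_div,
    inv_mul_cancel₀ hp.ne', Real.rpow_one, two_mul]
  exact (hX.add_rpow_le x y).trans (add_le_add
    (Real.rpow_le_rpow (hX.nonneg x) hx hp.le) (Real.rpow_le_rpow (hX.nonneg y) hy hp.le))

theorem norm_sub_le_of_le (hX : IsPBanach p 𝕜 X) {x y : X} {a : ℝ}
    (hx : ‖x‖ ≤ a) (hy : ‖y‖ ≤ a) : ‖x - y‖ ≤ 2 ^ (1 / p) * a := by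
  rw [sub_eq_add_neg]
  exact hX.norm_add_le_of_le hx (by rwa [hX.norm_neg])

theorem norm_le_rpow_of_rpow_le (hX : IsPBanach p 𝕜 X) {x : X} {a : ℝ}
    (h : ‖x‖ ^ p ≤ a) : ‖x‖ ≤ a ^ (1 / p) := by
  have := Real.rpow_le_rpow (Real.rpow_nonneg (hX.nonneg x) p) h (one_div_pos.2 hX.p_pos).le
  rwa [← Real.rpow_mul (hX.nonneg x), mul_one_div_cancel hX.p_pos.ne', Real.rpow_one] at this

end IsPBanach

/-! ### Indicator vectors as linear combinations. -/

section Indicators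

variable {𝕜 : Type v} {X : Type u} [RCLike 𝕜] [AddCommGroup X] [Module 𝕜 X]

theorem linearCombination_eq_signedIndicator (e : ℕ → X) (ε : ℕ → 𝕜) (A : Finset ℕ) :
    Finsupp.linearCombination 𝕜 e (∑ n ∈ A, Finsupp.single n (ε n)) = signedIndicator e ε A := by
  simp [signedIndicator, map_sum]

theorem signedIndicator_one (e : ℕ → X) (A : Finset ℕ) :
    signedIndicator e (fun _ => (1 : 𝕜)) A = indicatorVec e A := by
  simp [signedIndicator, indicatorVec]

theorem sum_single_apply (c : ℕ → 𝕜) (A : Finset ℕ) (n : ℕ) :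
    (∑ k ∈ A, Finsupp.single k (c k)) n = if n ∈ A then c n else 0 := by
  simp [Finsupp.finsetSum_apply, Finsupp.single_apply]

end Indicators

/-! ### Coordinates and elementary bounds for a basis. -/

section BasisFacts

variable {p : ℝ} {𝕜 : Type v} {X : Type u} [RCLike 𝕜] [AddCommGroup X] [Module 𝕜 X] [Norm X]

theorem IsBoundedFunctional.le_functionalNorm (hX : IsPBanach p 𝕜 X) {f : X →ₗ[𝕜] 𝕜}
    (hf : IsBoundedFunctional f) (x : X) : ‖f x‖ ≤ functionalNorm f * ‖x‖ := by
  obtain ⟨C, hC⟩ := hf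
  have hbdd : BddAbove {t : ℝ | ∃ x : X, ‖x‖ ≤ 1 ∧ t = ‖f x‖} := by
    refine ⟨|C|, ?_⟩
    rintro _ ⟨x, hx, rfl⟩
    have := hC x
    nlinarith [le_abs_self C, hX.nonneg x, abs_nonneg C]
  rcases (hX.nonneg x).eq_or_lt with h0 | h0
  · have hx : x = 0 := (hX.eq_zero_iff x).1 h0.symm
    simp [hx, hX.norm_zero]
  · have h1 : ‖((‖x‖⁻¹ : ℝ) : 𝕜) • x‖ ≤ 1 := by
      rw [hX.smul, RCLike.norm_ofReal, abs_of_pos (inv_pos.2 h0), inv_mul_cancel₀ h0.ne']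
    have h2 : ‖f (((‖x‖⁻¹ : ℝ) : 𝕜) • x)‖ ≤ functionalNorm f := le_csSup hbdd ⟨_, h1, rfl⟩
    rw [map_smul, smul_eq_mul, norm_mul, RCLike.norm_ofReal, abs_of_pos (inv_pos.2 h0),
      inv_mul_le_iff₀ h0] at h2
    linarith

variable {e : ℕ → X} {e' : ℕ → (X →ₗ[𝕜] 𝕜)}

theorem IsBasis.exists_bound (hX : IsPBanach p 𝕜 X) (h : IsBasis e e') :
    ∃ c : ℝ, 0 < c ∧ (∀ n, ‖e n‖ ≤ c) ∧ ∀ n x, ‖e' n x‖ ≤ c * ‖x‖ := by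
  obtain ⟨c₁, c₂, hc, H⟩ := h.seminormalized
  refine ⟨c₂, hc.trans_le ((H 0).1.trans (H 0).2.1), fun n => (H n).2.1, fun n x => ?_⟩
  exact ((h.bounded n).le_functionalNorm hX x).trans
    (mul_le_mul_of_nonneg_right (H n).2.2.2 (hX.nonneg x))

theorem IsBasis.coord_linearCombination (h : IsBasis e e') (a : ℕ →₀ 𝕜) (n : ℕ) :
    e' n (Finsupp.linearCombination 𝕜 e a) = a n := by
  rw [Finsupp.linearCombination_apply, Finsupp.sum, map_sum]
  simp only [map_smul, h.biorthogonal, smul_eq_mul, mul_ite, mul_one, mul_zero]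
  rw [Finset.sum_ite_eq]
  simp +contextual [eq_comm]

theorem coord_signedIndicator (h : IsBasis e e') (ε : ℕ → 𝕜) (A : Finset ℕ) (n : ℕ) :
    e' n (signedIndicator e ε A) = if n ∈ A then ε n else 0 := by
  rw [← linearCombination_eq_signedIndicator, h.coord_linearCombination, sum_single_apply]

theorem norm_signedIndicator_rpow_le (hX : IsPBanach p 𝕜 X) {c : ℝ} (hc : ∀ n, ‖e n‖ ≤ c)
    {ε : ℕ → 𝕜} (hε : IsSign ε) (A : Finset ℕ) :
    ‖signedIndicator e ε A‖ ^ p ≤ A.card * c ^ p := by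
  refine (hX.sum_rpow_le _ _).trans ?_
  rw [← nsmul_eq_mul]
  refine Finset.sum_le_card_nsmul _ _ _ fun n _ => ?_
  rw [hX.smul, hε n, one_mul]
  exact Real.rpow_le_rpow (hX.nonneg _) (hc n) hX.p_pos.le

end BasisFacts

/-! ### Completion for a norm homogeneous of degree r. -/

section Completion

open UniformSpace

variable {𝕜 : Type v} {E : Type u} [RCLike 𝕜] [NormedAddCommGroup E] [Module 𝕜 E]

theorem uniformContinuousConstSMul_of_norm_smul {r : ℝ}
    (hs : ∀ (c : 𝕜) (x : E), ‖c • x‖ = ‖c‖ ^ r * ‖x‖) : UniformContinuousConstSMul 𝕜 E := by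
  refine ⟨fun c => ?_⟩
  refine (LipschitzWith.of_dist_le_mul (K := ⟨‖c‖ ^ r, by positivity⟩) fun x y => ?_).uniformContinuous
  rw [dist_eq_norm, dist_eq_norm, ← smul_sub, hs]
  rfl

theorem norm_smul_completion {r : ℝ} [UniformContinuousConstSMul 𝕜 E]
    (hs : ∀ (c : 𝕜) (x : E), ‖c • x‖ = ‖c‖ ^ r * ‖x‖) (c : 𝕜) (x : Completion E) :
    ‖c • x‖ = ‖c‖ ^ r * ‖x‖ := by
  induction x using Completion.induction_on with
  | hp =>
    exact isClosed_eq (continuous_norm.comp (continuous_const_smul c))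
      (continuous_const.mul continuous_norm)
  | ih x => rw [← Completion.coe_smul, Completion.norm_coe, Completion.norm_coe, hs]

/-- The group norm plays the role of the r-th power of an r-norm. It is subadditive, so it can be
completed as an ordinary normed group, and the r-norm is recovered by taking the power 1/r. -/
theorem isPBanach_completion {r : ℝ} (hr : 0 < r) (hr1 : r ≤ 1) [UniformContinuousConstSMul 𝕜 E]
    (hs : ∀ (c : 𝕜) (x : E), ‖c • x‖ = ‖c‖ ^ r * ‖x‖) :
    @IsPBanach r 𝕜 (Completion E) _ _ _ ⟨fun x => ‖x‖ ^ (1 / r)⟩ := by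
  have key : ∀ x : Completion E, (‖x‖ ^ (1 / r)) ^ r = ‖x‖ := fun x => by
    rw [← Real.rpow_mul (norm_nonneg x), one_div, inv_mul_cancel₀ hr.ne', Real.rpow_one]
  have hlt : ∀ (x : Completion E) (η : ℝ), 0 < η → (‖x‖ ^ (1 / r) < η ↔ ‖x‖ < η ^ r) := by
    intro x η hη
    rw [← Real.rpow_lt_rpow_iff (Real.rpow_nonneg (norm_nonneg x) _) hη.le hr, key]
  refine @IsPBanach.mk r 𝕜 (Completion E) _ _ _ ⟨fun x => ‖x‖ ^ (1 / r)⟩ hr hr1 ?_ ?_ ?_ ?_ ?_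
  · intro x
    exact Real.rpow_nonneg (norm_nonneg x) _
  · intro x
    refine (Real.rpow_eq_zero (norm_nonneg x) (one_div_pos.2 hr).ne').trans norm_eq_zero
  · intro c x
    change ‖c • x‖ ^ (1 / r) = ‖c‖ * ‖x‖ ^ (1 / r)
    rw [norm_smul_completion hs, Real.mul_rpow (by positivity) (norm_nonneg x),
      ← Real.rpow_mul (norm_nonneg c), mul_one_div_cancel hr.ne', Real.rpow_one]
  · intro x y
    change (‖x + y‖ ^ (1 / r)) ^ r ≤ (‖x‖ ^ (1 / r)) ^ r + (‖y‖ ^ (1 / r)) ^ r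
    rw [key, key, key]
    exact norm_add_le x y
  · intro s hcs
    have hc : CauchySeq s := by
      rw [Metric.cauchySeq_iff]
      intro η hη
      obtain ⟨N, hN⟩ := hcs (η ^ (1 / r)) (by positivity)
      refine ⟨N, fun m hm n hn => ?_⟩
      have h1 : ‖s m - s n‖ ^ (1 / r) < η ^ (1 / r) := hN m n hm hn
      rw [dist_eq_norm]
      exact (Real.rpow_lt_rpow_iff (norm_nonneg _) hη.le (one_div_pos.2 hr)).1 h1
    obtain ⟨x, hx⟩ := cauchySeq_tendsto_of_complete hc
    refine ⟨x, fun η hη => ?_⟩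
    obtain ⟨N, hN⟩ := (Metric.tendsto_atTop.1 hx) (η ^ r) (by positivity)
    refine ⟨N, fun n hn => ?_⟩
    have h1 := hN n hn
    rw [dist_eq_norm] at h1
    exact (hlt _ η hη).2 h1

theorem exists_completion_functional {r : ℝ} (hr : 0 < r) [UniformContinuousConstSMul 𝕜 E]
    (f : E →ₗ[𝕜] 𝕜) {C : ℝ} (hC : ∀ x, ‖f x‖ ^ r ≤ C * ‖x‖) :
    ∃ g : Completion E →ₗ[𝕜] 𝕜, (∀ x : E, g x = f x) ∧ ∀ x, ‖g x‖ ^ r ≤ C * ‖x‖ := by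
  have hcont : Continuous f := by
    refine continuous_of_continuousAt_zero f ?_
    rw [ContinuousAt, map_zero, tendsto_zero_iff_norm_tendsto_zero]
    have h1 : Filter.Tendsto (fun x : E => (C * ‖x‖) ^ (1 / r)) (nhds 0) (nhds 0) := by
      have : Continuous (fun x : E => (C * ‖x‖) ^ (1 / r)) :=
        (continuous_const.mul continuous_norm).rpow_const fun _ => Or.inr (by positivity)
      have h := this.tendsto 0
      rwa [norm_zero, mul_zero, Real.zero_rpow (one_div_pos.2 hr).ne'] at h
    refine squeeze_zero (fun x => norm_nonneg _) (fun x => ?_) h1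
    have := Real.rpow_le_rpow (by positivity) (hC x) (one_div_pos.2 hr).le
    rwa [← Real.rpow_mul (norm_nonneg _), mul_one_div_cancel hr.ne', Real.rpow_one] at this
  let ι : E →L[𝕜] Completion E :=
    { toFun := fun x => (x : Completion E)
      map_add' := fun x y => Completion.coe_add x y
      map_smul' := fun c x => Completion.coe_smul c x
      cont := Completion.continuous_coe E }
  let g := ContinuousLinearMap.extend (⟨f, hcont⟩ : E →L[𝕜] 𝕜) ι
  have hg : ∀ x : E, g x = f x := fun x =>
    ContinuousLinearMap.extend_eq (⟨f, hcont⟩ : E →L[𝕜] 𝕜) (e := ι)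
      Completion.denseRange_coe (Completion.isUniformInducing_coe E) x
  refine ⟨g, hg, fun x => ?_⟩
  induction x using Completion.induction_on with
  | hp =>
    exact isClosed_le (g.continuous.norm.rpow_const fun _ => Or.inr hr.le)
      (continuous_const.mul continuous_norm)
  | ih x => simpa [hg] using hC x

end Completion

/-! ### Multipliers and large coefficients in symmetric sequences. -/

section Symmetric

variable {r : ℝ} {𝕜 : Type v} {Y : Type u} [RCLike 𝕜] [AddCommGroup Y] [Module 𝕜 Y] [Norm Y]
  {y : ℕ → Y} {y' : ℕ → (Y →ₗ[𝕜] 𝕜)}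

/-- Without convexity, a multiplier b with values in [0,1] cannot be averaged directly from signs.
Instead its binary digits are peeled off: b = (1_A + d)/2 with d again valued in [0,1]. Each halving
costs a factor 2^(-r) < 1 in the r-th power, so the supremum over all multipliers satisfies a
contracting inequality. -/
theorem IsSymmetricSeq.exists_mul_le (hY : IsPBanach r 𝕜 Y) (hs : IsSymmetricSeq 𝕜 y) :
    ∃ K : ℝ, 0 < K ∧ ∀ (a : ℕ →₀ 𝕜) (b : ℕ → ℝ), (∀ n, 0 ≤ b n) → (∀ n, b n ≤ 1) →
      ‖∑ n ∈ a.support, ((b n : 𝕜) * a n) • y n‖ ≤ K * ‖Finsupp.linearCombination 𝕜 y a‖ := by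
  classical
  obtain ⟨C, hC, hsym⟩ := hs
  have hr := hY.p_pos
  set q : ℝ := (1 / 2) ^ r with hq
  have hq0 : 0 < q := by positivity
  have hq1 : q < 1 := Real.rpow_lt_one (by norm_num) (by norm_num) hr
  refine ⟨(q * (q * (1 + C ^ r)) / (1 - q)) ^ (1 / r), ?_, fun a b hb0 hb1 => ?_⟩
  · have : 0 < 1 - q := by linarith
    positivity
  set V := ‖Finsupp.linearCombination 𝕜 y a‖ with hV
  have hV0 : 0 ≤ V := hY.nonneg _
  set F : (ℕ → ℝ) → ℝ := fun b => ‖∑ n ∈ a.support, ((b n : 𝕜) * a n) • y n‖ ^ r with hF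
  -- multipliers with values `0` and `1` are handled by averaging two changes of signs
  have hproj : ∀ A : Finset ℕ, F (fun n => if n ∈ A then 1 else 0) ≤ q * (1 + C ^ r) * V ^ r := by
    intro A
    have h1 : ∑ n ∈ a.support, (((if n ∈ A then 1 else 0 : ℝ) : 𝕜) * a n) • y n
        = ((1 / 2 : ℝ) : 𝕜) • (Finsupp.linearCombination 𝕜 y a +
          ∑ n ∈ a.support, ((if n ∈ A then 1 else -1 : 𝕜) * a n) • y ((1 : Equiv.Perm ℕ) n)) := by
      rw [Finsupp.linearCombination_apply, Finsupp.sum, ← Finset.sum_add_distrib, Finset.smul_sum]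
      refine Finset.sum_congr rfl fun n _ => ?_
      rw [Equiv.Perm.one_apply, ← add_smul, smul_smul]
      congr 1
      split_ifs
      · push_cast; ring
      · push_cast; ring
    have h2 := hsym 1 (fun n => if n ∈ A then 1 else -1)
      (fun n => by by_cases h : n ∈ A <;> simp [h]) a
    simp only [hF]
    rw [h1, hY.smul_rpow, RCLike.norm_ofReal, abs_of_pos (by norm_num), mul_assoc]
    refine mul_le_mul_of_nonneg_left ((hY.add_rpow_le _ _).trans ?_) hq0.le
    have h3 := Real.rpow_le_rpow (hY.nonneg _) h2 hr.le
    rw [Real.mul_rpow hC.le hV0] at h3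
    linarith
  have hbdd : ∀ b : ℕ → ℝ, (∀ n, 0 ≤ b n) → (∀ n, b n ≤ 1) →
      F b ≤ ∑ n ∈ a.support, ‖a n • y n‖ ^ r := by
    intro b hb0 hb1
    refine (hY.sum_rpow_le _ _).trans (Finset.sum_le_sum fun n _ => ?_)
    rw [mul_smul, hY.smul_rpow, RCLike.norm_ofReal, abs_of_nonneg (hb0 n)]
    exact mul_le_of_le_one_left (Real.rpow_nonneg (hY.nonneg _) _)
      (Real.rpow_le_one (hb0 n) (hb1 n) hr.le)
  set I := {b : ℕ → ℝ // (∀ n, 0 ≤ b n) ∧ ∀ n, b n ≤ 1}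
  have : Nonempty I := ⟨⟨fun _ => 0, fun _ => le_rfl, fun _ => zero_le_one⟩⟩
  have hB : BddAbove (Set.range fun b : I => F b.1) := by
    refine ⟨∑ n ∈ a.support, ‖a n • y n‖ ^ r, ?_⟩
    rintro _ ⟨b, rfl⟩
    exact hbdd b.1 b.2.1 b.2.2
  set G := ⨆ b : I, F b.1 with hG
  -- Since G is finite by `hB`, this inequality can be solved for G, which produces the denominator
  -- 1 - q.
  have hstep : G ≤ q * (q * (1 + C ^ r) * V ^ r + G) := by
    refine ciSup_le fun ⟨b, hb0, hb1⟩ => ?_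
    set A : Finset ℕ := a.support.filter fun n => 1 / 2 ≤ b n with hA
    -- Off the support of a the digit set A is empty and 2b could exceed 1, so d is set to 0 there.
    set d : ℕ → ℝ := fun n => if n ∈ a.support then 2 * b n - (if n ∈ A then 1 else 0) else 0
      with hd
    have hd0 : ∀ n, 0 ≤ d n := by
      intro n
      simp only [hd, hA, Finset.mem_filter]
      split_ifs with h1 h2
      · linarith [h2.2]
      · linarith [hb0 n]
      · exact le_rfl
    have hd1 : ∀ n, d n ≤ 1 := by
      intro n
      simp only [hd, hA, Finset.mem_filter]
      split_ifs with h1 h2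
      · linarith [hb1 n]
      · have : b n < 1 / 2 := not_le.1 fun h => h2 ⟨h1, h⟩
        linarith
      · exact zero_le_one
    have h1 : ∑ n ∈ a.support, ((b n : 𝕜) * a n) • y n
        = ((1 / 2 : ℝ) : 𝕜) • (∑ n ∈ a.support, (((if n ∈ A then 1 else 0 : ℝ) : 𝕜) * a n) • y n +
          ∑ n ∈ a.support, ((d n : 𝕜) * a n) • y n) := by
      rw [← Finset.sum_add_distrib, Finset.smul_sum]
      refine Finset.sum_congr rfl fun n hn => ?_
      rw [← add_smul, smul_smul]
      congr 1
      simp only [hd, if_pos hn]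
      push_cast
      ring
    have h2 : F d ≤ G := le_ciSup hB (⟨d, hd0, hd1⟩ : I)
    change F b ≤ _
    simp only [hF]
    rw [h1, hY.smul_rpow, RCLike.norm_ofReal, abs_of_pos (by norm_num)]
    exact mul_le_mul_of_nonneg_left ((hY.add_rpow_le _ _).trans (add_le_add (hproj A) h2)) hq0.le
  have hfin : F b ≤ q * (q * (1 + C ^ r)) / (1 - q) * V ^ r := by
    refine (le_ciSup hB (⟨b, hb0, hb1⟩ : I)).trans ?_
    rw [div_mul_eq_mul_div, le_div_iff₀ (by linarith)]
    nlinarith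
  have hK : 0 ≤ q * (q * (1 + C ^ r)) / (1 - q) := by
    have : 0 < 1 - q := by linarith
    positivity
  refine (hY.norm_le_rpow_of_rpow_le hfin).trans_eq ?_
  rw [Real.mul_rpow hK (by positivity), ← Real.rpow_mul hV0, mul_one_div_cancel hr.ne',
    Real.rpow_one]

/-- Symmetry is applied to the coefficients ε with the signs δ/ε, which handles signs and
permutation at once. -/
theorem IsSymmetricSeq.norm_signedIndicator_le {C : ℝ}
    (hC : ∀ (σ : Equiv.Perm ℕ) (ε : ℕ → 𝕜), IsSign ε → ∀ a : ℕ →₀ 𝕜,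
      ‖∑ n ∈ a.support, (ε n * a n) • y (σ n)‖ ≤ C * ‖Finsupp.linearCombination 𝕜 y a‖)
    (σ : Equiv.Perm ℕ) {ε δ : ℕ → 𝕜} (hε : IsSign ε) (hδ : IsSign δ) (A : Finset ℕ) :
    ‖∑ n ∈ A, δ n • y (σ n)‖ ≤ C * ‖signedIndicator y ε A‖ := by
  classical
  set a : ℕ →₀ 𝕜 := ∑ n ∈ A, Finsupp.single n (ε n) with ha
  have hne : ∀ n, ε n ≠ 0 := fun n h => by simpa [h] using hε n
  have hsupp : a.support = A := by
    ext n
    rw [Finsupp.mem_support_iff, ha, sum_single_apply]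
    simp [hne n]
  have h := hC σ (fun n => δ n * (ε n)⁻¹)
    (fun n => by rw [norm_mul, norm_inv, hε n, hδ n, inv_one, one_mul]) a
  rw [hsupp, ha, linearCombination_eq_signedIndicator] at h
  refine le_trans (le_of_eq ?_) h
  congr 1
  refine Finset.sum_congr rfl fun n hn => ?_
  rw [sum_single_apply, if_pos hn, mul_assoc, inv_mul_cancel₀ (hne n), mul_one]

/-- The multiplier t/|a_n| on |A| of the large coefficients, and 0 elsewhere, lies in [0,1] and
levels them to modulus t; a permutation then moves their positions onto A. -/
theorem IsSymmetricSeq.exists_large_coefficients (hY : IsPBanach r 𝕜 Y)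
    (hs : IsSymmetricSeq 𝕜 y) :
    ∃ K : ℝ, 0 < K ∧ ∀ (a : ℕ →₀ 𝕜) (D A : Finset ℕ) (t : ℝ), 0 < t → (∀ n ∈ D, t ≤ ‖a n‖) →
      A.card ≤ D.card → t * ‖indicatorVec y A‖ ≤ K * ‖Finsupp.linearCombination 𝕜 y a‖ := by
  classical
  obtain ⟨K, hK, hmul⟩ := hs.exists_mul_le hY
  obtain ⟨C, hC, hsym⟩ := hs
  refine ⟨C * K, by positivity, fun a D A t ht hD hcard => ?_⟩
  obtain ⟨D', hD', hcard'⟩ := Finset.exists_subset_card_eq hcard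
  obtain ⟨σ, rfl⟩ := Equiv.Perm.exists_map_finset_eq D' A hcard'
  have hpos : ∀ n ∈ D', 0 < ‖a n‖ := fun n hn => ht.trans_le (hD n (hD' hn))
  have h1 := hmul a (fun n => if n ∈ D' then t / ‖a n‖ else 0)
    (fun n => by split_ifs <;> positivity)
    (fun n => by
      split_ifs with h
      · exact (div_le_one (hpos n h)).2 (hD n (hD' h))
      · exact zero_le_one)
  set ε : ℕ → 𝕜 := fun n => if n ∈ D' then a n / (‖a n‖ : 𝕜) else 1 with hε
  have hεs : IsSign ε := by
    intro n
    simp only [hε]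
    split_ifs with h
    · rw [norm_div, RCLike.norm_ofReal, abs_of_pos (hpos n h), div_self (hpos n h).ne']
    · exact norm_one
  have h2 : ∑ n ∈ a.support, (((if n ∈ D' then t / ‖a n‖ else 0 : ℝ) : 𝕜) * a n) • y n
      = (t : 𝕜) • signedIndicator y ε D' := by
    have hsub : D' ⊆ a.support := fun n hn =>
      Finsupp.mem_support_iff.2 (norm_pos_iff.1 (hpos n hn))
    rw [signedIndicator, Finset.smul_sum, ← Finset.sum_subset hsub]
    · refine Finset.sum_congr rfl fun n hn => ?_
      rw [smul_smul]
      simp only [hε, if_pos hn]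
      congr 1
      push_cast
      ring
    · intro n _ hn
      simp [hn]
  rw [h2, hY.smul, RCLike.norm_ofReal, abs_of_pos ht] at h1
  have h3 := IsSymmetricSeq.norm_signedIndicator_le hsym σ hεs (fun _ => norm_one) D'
  simp only [one_smul] at h3
  have h4 : indicatorVec y (D'.map σ.toEmbedding) = ∑ n ∈ D', y (σ n) := by
    simp [indicatorVec]
  rw [h4]
  nlinarith

end Symmetric

/-! ### From squeeze symmetry to large coefficients, then to (ii) and (iii). -/

section SqueezeSymmetric

variable {p : ℝ} {𝕜 : Type v} {X : Type u} [RCLike 𝕜] [AddCommGroup X] [Module 𝕜 X] [Norm X]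
  {e : ℕ → X} {e' : ℕ → (X →ₗ[𝕜] 𝕜)}

theorem bddAbove_fundamentalFunction (hX : IsPBanach p 𝕜 X) {c : ℝ} (hc : ∀ n, ‖e n‖ ≤ c)
    (m : ℕ) : BddAbove {t : ℝ | ∃ A : Finset ℕ, A.card ≤ m ∧ t = ‖indicatorVec e A‖} := by
  have hc0 : 0 ≤ c := (hX.nonneg _).trans (hc 0)
  refine ⟨(m * c ^ p) ^ (1 / p), ?_⟩
  rintro _ ⟨A, hA, rfl⟩
  refine hX.norm_le_rpow_of_rpow_le ?_
  rw [← signedIndicator_one (𝕜 := 𝕜)]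
  refine (norm_signedIndicator_rpow_le (𝕜 := 𝕜) hX hc (fun _ => norm_one) A).trans ?_
  gcongr

variable (𝕜) in
/-- Uniform lower bound for the norm of a vector with a given number of large coefficients, in
terms of the norms of signed indicator vectors. -/
def LargeCoefficientEstimate (e : ℕ → X) : Prop :=
  ∃ K : ℝ, 0 < K ∧ ∀ (a : ℕ →₀ 𝕜) (D A : Finset ℕ) (t : ℝ), 0 < t → (∀ n ∈ D, t ≤ ‖a n‖) →
    A.card ≤ D.card → ∀ ε : ℕ → 𝕜, IsSign ε →
      t * ‖signedIndicator e ε A‖ ≤ K * ‖Finsupp.linearCombination 𝕜 e a‖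

theorem IsSqueezeSymmetric.largeCoefficientEstimate (h : IsSqueezeSymmetric 𝕜 e) :
    LargeCoefficientEstimate 𝕜 e := by
  obtain ⟨S, T, ⟨C₁, hC₁, hS⟩, ⟨C₂, hC₂, hT⟩, C₃, hC₃, hφ⟩ := h
  obtain ⟨cS, -, hcS, -⟩ := S.isBasis.exists_bound S.isPBanach
  obtain ⟨K, hK, hlarge⟩ := T.isSymmetric.exists_large_coefficients T.isPBanach
  obtain ⟨C₄, hC₄, hsym⟩ := S.isSymmetric
  refine ⟨C₁ * C₄ * C₃ * K * C₂, by positivity, fun a D A t ht hD hcard ε hε => ?_⟩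
  have h1 : ‖signedIndicator e ε A‖ ≤ C₁ * ‖signedIndicator S.vec ε A‖ := by
    have := hS (∑ n ∈ A, Finsupp.single n (ε n))
    rwa [linearCombination_eq_signedIndicator, linearCombination_eq_signedIndicator] at this
  have h2 : ‖signedIndicator S.vec ε A‖ ≤ C₄ * ‖indicatorVec S.vec A‖ := by
    have := IsSymmetricSeq.norm_signedIndicator_le hsym 1 (ε := fun _ => 1) (δ := ε)
      (fun _ => norm_one) hε A
    rwa [signedIndicator_one] at this
  have h3 : ‖indicatorVec S.vec A‖ ≤ fundamentalFunction S.vec A.card :=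
    le_csSup (bddAbove_fundamentalFunction S.isPBanach hcS A.card) ⟨A, le_rfl, rfl⟩
  have h4 : fundamentalFunction T.vec A.card
      ≤ K * ‖Finsupp.linearCombination 𝕜 T.vec a‖ / t := by
    refine csSup_le ⟨_, ∅, by simp, rfl⟩ ?_
    rintro _ ⟨A', hA', rfl⟩
    rw [le_div_iff₀ ht, mul_comm]
    exact hlarge a D A' t ht hD (hA'.trans hcard)
  calc t * ‖signedIndicator e ε A‖
      ≤ t * (C₁ * (C₄ * (C₃ * (K * (C₂ * ‖Finsupp.linearCombination 𝕜 e a‖) / t)))) := by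
        gcongr
        refine h1.trans ?_
        gcongr
        refine h2.trans ?_
        gcongr
        refine h3.trans ((hφ _).1.trans ?_)
        gcongr
        refine h4.trans ?_
        gcongr
        exact hT a
    _ = _ := by field_simp

/-- Density of the span extends the estimate from finite combinations to all vectors. -/
theorem LargeCoefficientEstimate.exists_forall (hX : IsPBanach p 𝕜 X) (hB : IsBasis e e')
    (h : LargeCoefficientEstimate 𝕜 e) :
    ∃ K : ℝ, 0 < K ∧ ∀ (x : X) (D A : Finset ℕ) (t : ℝ), 0 < t → (∀ n ∈ D, t ≤ ‖e' n x‖) →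
      A.card ≤ D.card → ∀ ε : ℕ → 𝕜, IsSign ε → t * ‖signedIndicator e ε A‖ ≤ K * ‖x‖ := by
  obtain ⟨K, hK, hlarge⟩ := h
  obtain ⟨c, hc, -, hcoord⟩ := hB.exists_bound hX
  refine ⟨2 * (K * 2 ^ (1 / p)), by positivity, fun x D A t ht hD hcard ε hε => ?_⟩
  rcases A.eq_empty_or_nonempty with rfl | hA
  · simp only [signedIndicator, Finset.sum_empty, hX.norm_zero, mul_zero]
    have := hX.nonneg x
    positivity
  obtain ⟨n₀, hn₀⟩ := Finset.card_pos.1 (hA.card_pos.trans_le hcard)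
  have hx : 0 < ‖x‖ := by
    have h1 := (hD n₀ hn₀).trans (hcoord n₀ x)
    by_contra h2
    nlinarith
  -- The first bound keeps the norm of the approximant below 2^(1/p)‖x‖; the second costs each
  -- coordinate at most t/2.
  obtain ⟨y, hy, hxy⟩ := hB.dense x (min ‖x‖ (t / (2 * c))) (lt_min hx (by positivity))
  rw [← Finsupp.range_linearCombination] at hy
  obtain ⟨a, rfl⟩ := hy
  have hxy1 := (hxy.trans_le (min_le_left _ _)).le
  have hxy2 := (hxy.trans_le (min_le_right _ _)).le
  have hD' : ∀ n ∈ D, t / 2 ≤ ‖a n‖ := by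
    intro n hn
    have h1 := hcoord n (x - Finsupp.linearCombination 𝕜 e a)
    rw [map_sub, hB.coord_linearCombination] at h1
    have h2 : c * ‖x - Finsupp.linearCombination 𝕜 e a‖ ≤ t / 2 := by
      refine (mul_le_mul_of_nonneg_left hxy2 hc.le).trans_eq ?_
      field_simp
    have h3 := norm_sub_norm_le (e' n x) (a n)
    linarith [hD n hn]
  have h1 := hlarge a D A (t / 2) (by positivity) hD' hcard ε hε
  have h2 : ‖Finsupp.linearCombination 𝕜 e a‖ ≤ 2 ^ (1 / p) * ‖x‖ := by
    have := hX.norm_sub_le_of_le (x := x) le_rfl hxy1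
    rwa [sub_sub_cancel] at this
  nlinarith

theorem LargeCoefficientEstimate.oneDimApprox (hX : IsPBanach p 𝕜 X) (hB : IsBasis e e')
    (h : LargeCoefficientEstimate 𝕜 e) : OneDimApprox e e' := by
  classical
  obtain ⟨K, hK, hlarge⟩ := h.exists_forall hX hB
  set q : ℝ := 2 ^ (1 / p) with hq
  have hq0 : 0 < q := by positivity
  refine ⟨q * (1 + q * (2 * K)), by positivity, fun x A B hA hcard hsupp ε δ hε hδ hεδ lam => ?_⟩
  set y := x + lam • signedIndicator e δ B with hy
  have hy0 := hX.nonneg y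
  have hcoord : ∀ n, e' n y = e' n x + if n ∈ B then lam * δ n else 0 := by
    intro n
    rw [hy, map_add, map_smul, coord_signedIndicator hB]
    split_ifs <;> simp
  have hAB : (A \ B).card ≤ (B \ A).card := by
    have h1 := Finset.card_sdiff_add_card_inter A B
    have h2 := Finset.card_sdiff_add_card_inter B A
    rw [Finset.inter_comm] at h2
    omega
  -- If x has a coefficient below |λ|/2 on A, greediness makes all its coefficients off A smaller
  -- than |λ|/2, and D = B \ A works. Otherwise y is large on A \ B, where it agrees with x, and on
  -- B outside supp x, where its modulus is |λ|. These sets suffice because |B ∩ supp x| ≤ |A| gives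
  -- |A \ B| + |B \ supp x| ≥ |B \ A|.
  have key : ∃ D : Finset ℕ, (∀ n ∈ D, ‖lam‖ / 2 ≤ ‖e' n y‖) ∧ (B \ A).card ≤ D.card := by
    by_cases hsmall : ∃ n ∈ A, ‖e' n x‖ < ‖lam‖ / 2
    · obtain ⟨n₀, hn₀, hlt⟩ := hsmall
      refine ⟨B \ A, fun n hn => ?_, le_rfl⟩
      obtain ⟨hnB, hnA⟩ := Finset.mem_sdiff.1 hn
      have h1 := hA n₀ hn₀ n hnA
      rw [hcoord, if_pos hnB]
      have h2 := norm_sub_le (e' n x + lam * δ n) (e' n x)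
      rw [add_sub_cancel_left, norm_mul, hδ n, mul_one] at h2
      linarith
    · push Not at hsmall
      refine ⟨(A \ B) ∪ B.filter fun n => e' n x = 0, fun n hn => ?_, ?_⟩
      · rcases Finset.mem_union.1 hn with hn | hn
        · obtain ⟨hnA, hnB⟩ := Finset.mem_sdiff.1 hn
          rw [hcoord, if_neg hnB, add_zero]
          exact hsmall n hnA
        · obtain ⟨hnB, hn0⟩ := Finset.mem_filter.1 hn
          rw [hcoord, if_pos hnB, hn0, zero_add, norm_mul, hδ n, mul_one]
          linarith [norm_nonneg lam]
      · have hset : (B : Set ℕ) ∩ basisSupport e' x = (B.filter fun n => ¬ e' n x = 0 : Finset ℕ) := by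
          ext n
          simp [basisSupport]
        rw [hset, Set.ncard_coe_finset] at hsupp
        rw [Finset.card_union_of_disjoint]
        · have h1 := Finset.card_sdiff_add_card_inter A B
          have h2 := Finset.card_sdiff_add_card_inter B A
          have h3 := Finset.card_filter_add_card_filter_not (s := B) fun n => e' n x = 0
          rw [Finset.inter_comm] at h2
          omega
        · exact Finset.disjoint_left.2 fun n hn hn' =>
            (Finset.mem_sdiff.1 hn).2 (Finset.mem_filter.1 hn').1
  obtain ⟨D, hD, hDcard⟩ := key
  have hbound : ∀ (E : Finset ℕ) (s : ℕ → 𝕜), IsSign s → E.card ≤ D.card →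
      ‖lam • signedIndicator e s E‖ ≤ 2 * K * ‖y‖ := by
    intro E s hs hE
    rw [hX.smul]
    rcases (norm_nonneg lam).eq_or_lt with h0 | h0
    · rw [← h0, zero_mul]
      positivity
    · have := hlarge y D E (‖lam‖ / 2) (by positivity) hD hE s hs
      linarith
  have h1 := hX.norm_sub_le_of_le (hbound (A \ B) ε hε (hAB.trans hDcard))
    (hbound (B \ A) δ hδ hDcard)
  have h2 : x + lam • signedIndicator e ε A
      = y + (lam • signedIndicator e ε (A \ B) - lam • signedIndicator e δ (B \ A)) := by
    have h3 : signedIndicator e ε (A ∩ B) = signedIndicator e δ (A ∩ B) :=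
      Finset.sum_congr rfl fun n hn => by rw [hεδ n hn]
    have h4 : signedIndicator e ε A = signedIndicator e ε (A ∩ B) + signedIndicator e ε (A \ B) :=
      (Finset.sum_inter_add_sum_sdiff A B _).symm
    have h5 : signedIndicator e δ B = signedIndicator e δ (A ∩ B) + signedIndicator e δ (B \ A) := by
      rw [Finset.inter_comm]
      exact (Finset.sum_inter_add_sum_sdiff B A _).symm
    rw [hy, h4, h5, h3]
    simp only [smul_add]
    abel
  rw [h2, mul_assoc]
  refine hX.norm_add_le_of_le ?_ (h1.trans ?_)
  · have : 0 ≤ q * (2 * K) * ‖y‖ := by positivity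
    linarith
  · linarith

theorem OneDimApprox.disjointOneDimApprox (h : OneDimApprox e e') :
    DisjointOneDimApprox e e' := by
  classical
  obtain ⟨C, hC, H⟩ := h
  refine ⟨C, hC, fun x A B hA hB hcard hdisj ε hε => ?_⟩
  have h1 := H x A B hA hcard.ge
    (by rw [Set.inter_eq_left.2 hB, Set.ncard_coe_finset, hcard]) (fun _ => 1) ε
    (fun _ => norm_one) hε (by simp [Finset.disjoint_iff_inter_eq_empty.1 hdisj]) (-1)
  simpa [signedIndicator_one, ← sub_eq_add_neg] using h1

end SqueezeSymmetric

/-! ### From (iii) to the large coefficient estimate. -/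

section Disjoint

variable {p : ℝ} {𝕜 : Type v} {X : Type u} [RCLike 𝕜] [AddCommGroup X] [Module 𝕜 X] [Norm X]
  {e : ℕ → X} {e' : ℕ → (X →ₗ[𝕜] 𝕜)}

theorem exists_card_eq_disjoint (F : Finset ℕ) (m : ℕ) :
    ∃ B : Finset ℕ, Disjoint B F ∧ B.card = m := by
  obtain ⟨B, hB, hcard⟩ := F.finite_toSet.infinite_compl.exists_subset_card_eq m
  exact ⟨B, Finset.disjoint_left.2 fun n hn => by simpa using hB hn, hcard⟩

theorem DisjointOneDimApprox.exists_disjoint_estimate (hX : IsPBanach p 𝕜 X) (hB : IsBasis e e')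
    (h : DisjointOneDimApprox e e') :
    ∃ K : ℝ, 0 < K ∧ ∀ (a : ℕ →₀ 𝕜) (D A : Finset ℕ) (t : ℝ), 0 < t → (∀ n ∈ D, t ≤ ‖a n‖) →
      A.card ≤ D.card → Disjoint A a.support → ∀ ε : ℕ → 𝕜, IsSign ε →
        t * ‖signedIndicator e ε A‖ ≤ K * ‖Finsupp.linearCombination 𝕜 e a‖ := by
  classical
  obtain ⟨C, hC, H⟩ := h
  refine ⟨2 ^ (1 / p) * C, by positivity, fun a D A t ht hD hcard hdisj ε hε => ?_⟩
  -- D itself need not be greedy, but the full level set G is. A is padded by a fresh set F to match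
  -- its cardinality, as (iii) requires.
  set G : Finset ℕ := a.support.filter fun n => t ≤ ‖a n‖ with hG
  have hGmem : ∀ n, n ∈ G ↔ t ≤ ‖a n‖ := fun n => by
    simp only [hG, Finset.mem_filter, Finsupp.mem_support_iff, and_iff_right_iff_imp]
    rintro h1 h2
    rw [h2, norm_zero] at h1
    linarith
  have hDG : D ⊆ G := fun n hn => (hGmem n).2 (hD n hn)
  obtain ⟨F, hF, hFcard⟩ := exists_card_eq_disjoint (A ∪ a.support) (G.card - A.card)
  rw [Finset.disjoint_union_right] at hF
  have hcard' : (A ∪ F).card = G.card := by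
    rw [Finset.card_union_of_disjoint hF.1.symm, hFcard]
    have := Finset.card_le_card hDG
    omega
  have hzero : ∀ n ∈ A ∪ F, a n = 0 := fun n hn => by
    by_contra h0
    have hs := Finsupp.mem_support_iff.2 h0
    rcases Finset.mem_union.1 hn with hn | hn
    · exact Finset.disjoint_left.1 hdisj hn hs
    · exact Finset.disjoint_left.1 hF.2 hn hs
  have hGdisj : Disjoint G (A ∪ F) := Finset.disjoint_left.2 fun n hn hn' => by
    have h1 := (hGmem n).1 hn
    rw [hzero n hn', norm_zero] at h1
    linarith
  set f := Finsupp.linearCombination 𝕜 e a with hf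
  set g := ((t⁻¹ : ℝ) : 𝕜) • f with hg
  have hcoord : ∀ n, ‖e' n g‖ = t⁻¹ * ‖a n‖ := fun n => by
    rw [hg, map_smul, hf, hB.coord_linearCombination, smul_eq_mul, norm_mul, RCLike.norm_ofReal,
      abs_of_pos (inv_pos.2 ht)]
  -- After division by t, the coefficients of g have modulus at least 1 on G and less than 1 off G,
  -- so G remains greedy when unimodular coefficients are added on A ∪ F. Subtracting those again
  -- leaves g on the right of (iii).
  have key : ∀ s : ℕ → 𝕜, IsSign s →
      ‖g + signedIndicator e s (A ∪ F) - indicatorVec e G‖ ≤ C * ‖g‖ := by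
    intro s hs
    have hc1 : ∀ n ∈ A ∪ F, e' n (g + signedIndicator e s (A ∪ F)) = s n := fun n hn => by
      have h0 : e' n g = 0 := by
        rw [← norm_eq_zero, hcoord, hzero n hn, norm_zero, mul_zero]
      rw [map_add, coord_signedIndicator hB, if_pos hn, h0, zero_add]
    have hc2 : ∀ n ∉ A ∪ F, e' n (g + signedIndicator e s (A ∪ F)) = e' n g := fun n hn => by
      rw [map_add, coord_signedIndicator hB, if_neg hn, add_zero]
    have h1 := H (g + signedIndicator e s (A ∪ F)) G (A ∪ F) ?_ ?_ hcard' hGdisj s hs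
    · rwa [add_sub_cancel_right] at h1
    · intro n hn k hk
      have hn1 := (hGmem n).1 hn
      have hk1 : ‖a k‖ < t := not_le.1 fun hk' => hk ((hGmem k).2 hk')
      rw [hc2 n (Finset.disjoint_left.1 hGdisj hn), hcoord]
      have hn2 : 1 ≤ t⁻¹ * ‖a n‖ := by
        rw [inv_mul_eq_div]
        exact (one_le_div ht).2 hn1
      by_cases hkB : k ∈ A ∪ F
      · rw [hc1 k hkB, hs k]
        exact hn2
      · rw [hc2 k hkB, hcoord]
        exact mul_le_mul_of_nonneg_left (hk1.le.trans hn1) (inv_pos.2 ht).le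
    · intro n hn
      have h2 : e' n (g + signedIndicator e s (A ∪ F)) = s n := hc1 n hn
      change e' n _ ≠ 0
      rw [h2]
      intro h3
      simpa [h3] using hs n
  -- the two sign choices are opposite on `A` and coincide on `F`
  have h1 := key ε hε
  have h2 := key (fun n => if n ∈ A then -ε n else ε n)
    (fun n => by by_cases hn : n ∈ A <;> simp [hn, hε n])
  have h3 := hX.norm_sub_le_of_le h1 h2
  have h4 : g + signedIndicator e ε (A ∪ F) - indicatorVec e G -
      (g + signedIndicator e (fun n => if n ∈ A then -ε n else ε n) (A ∪ F) - indicatorVec e G)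
      = (2 : 𝕜) • signedIndicator e ε A := by
    have h5 : signedIndicator e ε F
        = signedIndicator e (fun n => if n ∈ A then -ε n else ε n) F :=
      Finset.sum_congr rfl fun n hn => by
        dsimp only
        rw [if_neg (Finset.disjoint_left.1 hF.1 hn)]
    have h6 : signedIndicator e (fun n => if n ∈ A then -ε n else ε n) A
        = -signedIndicator e ε A := by
      rw [signedIndicator, signedIndicator, ← Finset.sum_neg_distrib]
      exact Finset.sum_congr rfl fun n hn => by
        rw [if_pos hn, neg_smul]
    have hun : ∀ s : ℕ → 𝕜, signedIndicator e s (A ∪ F)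
        = signedIndicator e s A + signedIndicator e s F := fun s =>
      Finset.sum_union hF.1.symm
    rw [hun, hun, ← h5, h6, two_smul]
    abel
  rw [h4, hX.smul, RCLike.norm_ofNat, hg, hX.smul, RCLike.norm_ofReal,
    abs_of_pos (inv_pos.2 ht)] at h3
  have h7 : ‖signedIndicator e ε A‖ ≤ t⁻¹ * (2 ^ (1 / p) * C * ‖f‖) := by
    have := hX.nonneg (signedIndicator e ε A)
    linarith
  calc t * ‖signedIndicator e ε A‖ ≤ t * (t⁻¹ * (2 ^ (1 / p) * C * ‖f‖)) := by gcongr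
    _ = _ := by field_simp

/-- A set B of size |A|, disjoint from A and from the support of a, serves as a relay: the disjoint
estimate bounds 1_B by the given vector, then 1_{ε,A} by 1_B. -/
theorem DisjointOneDimApprox.largeCoefficientEstimate (hX : IsPBanach p 𝕜 X) (hB : IsBasis e e')
    (h : DisjointOneDimApprox e e') : LargeCoefficientEstimate 𝕜 e := by
  classical
  obtain ⟨K, hK, H⟩ := h.exists_disjoint_estimate hX hB
  refine ⟨K * K, by positivity, fun a D A t ht hD hcard ε hε => ?_⟩
  obtain ⟨B, hBd, hBcard⟩ := exists_card_eq_disjoint (A ∪ a.support) A.card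
  rw [Finset.disjoint_union_right] at hBd
  have h1 := H a D B t ht hD (hBcard.trans_le hcard) hBd.2 (fun _ => 1) (fun _ => norm_one)
  have h2 := H (∑ n ∈ B, Finsupp.single n 1) B A 1 one_pos
    (fun n hn => by rw [sum_single_apply (fun _ => (1 : 𝕜)), if_pos hn, norm_one]) hBcard.ge
    (Finset.disjoint_left.2 fun n hn hn' => by
      rw [Finsupp.mem_support_iff, sum_single_apply (fun _ => (1 : 𝕜))] at hn'
      exact hn' (if_neg (Finset.disjoint_right.1 hBd.1 hn))) ε hε
  rw [linearCombination_eq_signedIndicator e (fun _ => (1 : 𝕜))] at h2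
  nlinarith

end Disjoint

/-! ### Symmetric bases from invariant families of functionals. -/

section Construction

open UniformSpace in
/-- Completion of a vector space with respect to a norm which is homogeneous of degree `r`, with
the associated `r`-norm. -/
theorem exists_pBanach_completion {𝕜 : Type v} {E : Type u} [RCLike 𝕜] [AddCommGroup E]
    [Module 𝕜 E] {r : ℝ} (hr : 0 < r) (hr1 : r ≤ 1) (N : AddGroupNorm E)
    (hN : ∀ (c : 𝕜) (x : E), N (c • x) = ‖c‖ ^ r * N x) :
    ∃ (Y : Type u) (_ : AddCommGroup Y) (_ : Module 𝕜 Y) (_ : Norm Y) (j : E →ₗ[𝕜] Y),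
      IsPBanach r 𝕜 Y ∧ (∀ x, ‖j x‖ = N x ^ (1 / r)) ∧
      (∀ (y : Y) (η : ℝ), 0 < η → ∃ x, ‖y - j x‖ < η) ∧
      ∀ (f : E →ₗ[𝕜] 𝕜) (C : ℝ), 0 ≤ C → (∀ x, ‖f x‖ ≤ C * ‖j x‖) →
        ∃ g : Y →ₗ[𝕜] 𝕜, (∀ x, g (j x) = f x) ∧ ∀ y, ‖g y‖ ≤ C * ‖y‖ := by
  let _ := N.toNormedAddCommGroup
  have hs : ∀ (c : 𝕜) (x : E), ‖c • x‖ = ‖c‖ ^ r * ‖x‖ := hN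
  have := uniformContinuousConstSMul_of_norm_smul hs
  have hinv : 0 < 1 / r := one_div_pos.2 hr
  let j : E →ₗ[𝕜] Completion E :=
    { toFun := fun x => (x : Completion E)
      map_add' := fun x y => Completion.coe_add x y
      map_smul' := fun c x => Completion.coe_smul c x }
  have hrr : ∀ s : ℝ, 0 ≤ s → (s ^ (1 / r)) ^ r = s := fun s h => by
    rw [← Real.rpow_mul h, one_div, inv_mul_cancel₀ hr.ne', Real.rpow_one]
  refine ⟨Completion E, inferInstance, inferInstance, ⟨fun x => ‖x‖ ^ (1 / r)⟩, j,
    isPBanach_completion hr hr1 hs, fun x => ?_, fun y η hη => ?_, fun f C hC hf => ?_⟩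
  · change ‖(x : Completion E)‖ ^ (1 / r) = _
    rw [Completion.norm_coe]
    rfl
  · obtain ⟨_, hx, ⟨x, rfl⟩⟩ := Metric.dense_iff.1 (Completion.denseRange_coe (α := E)) y (η ^ r)
      (by positivity)
    refine ⟨x, ?_⟩
    change ‖y - (x : Completion E)‖ ^ (1 / r) < η
    rw [Metric.mem_ball, dist_comm, dist_eq_norm] at hx
    rwa [← Real.rpow_lt_rpow_iff (by positivity) hη.le hr, hrr _ (norm_nonneg _)]
  · have hf' : ∀ x, ‖f x‖ ^ r ≤ C ^ r * ‖x‖ := fun x => by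
      have h1 : ‖f x‖ ≤ C * ‖x‖ ^ (1 / r) := by
        have h2 : ‖f x‖ ≤ C * ‖(x : Completion E)‖ ^ (1 / r) := hf x
        rwa [Completion.norm_coe] at h2
      refine (Real.rpow_le_rpow (norm_nonneg _) h1 hr.le).trans_eq ?_
      rw [Real.mul_rpow hC (by positivity), hrr _ (norm_nonneg _)]
    obtain ⟨g, hg, hbound⟩ := exists_completion_functional hr f hf'
    refine ⟨g, hg, fun y => ?_⟩
    change ‖g y‖ ≤ C * ‖y‖ ^ (1 / r)
    rw [← Real.rpow_le_rpow_iff (norm_nonneg _) (by positivity) hr,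
      Real.mul_rpow hC (by positivity), hrr _ (norm_nonneg _)]
    exact hbound y

/-- Upper bounds suffice: 1 = e'_n(e_n) turns each of them into a lower bound for the other factor.
-/
theorem IsBasis.of_bounds {p : ℝ} {𝕜 : Type v} {X : Type u} [RCLike 𝕜] [AddCommGroup X]
    [Module 𝕜 X] [Norm X] {e : ℕ → X} {e' : ℕ → (X →ₗ[𝕜] 𝕜)} (hX : IsPBanach p 𝕜 X)
    (hdense : ∀ (x : X) (η : ℝ), 0 < η → ∃ y ∈ Submodule.span 𝕜 (Set.range e), ‖x - y‖ < η)
    (hbi : ∀ j k : ℕ, e' j (e k) = if j = k then 1 else 0) {c : ℝ} (hc : 0 < c)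
    (he : ∀ n, ‖e n‖ ≤ c) (he' : ∀ n x, ‖e' n x‖ ≤ c * ‖x‖) : IsBasis e e' := by
  refine ⟨hdense, fun n => ⟨c, he' n⟩, hbi, c⁻¹, c, inv_pos.2 hc, fun n => ⟨?_, he n, ?_, ?_⟩⟩
  · have := he' n (e n)
    rw [hbi, if_pos rfl, norm_one] at this
    rwa [inv_le_iff_one_le_mul₀' hc]
  · have h1 := IsBoundedFunctional.le_functionalNorm hX ⟨c, he' n⟩ (e n)
    rw [hbi, if_pos rfl, norm_one] at h1
    have h2 : 0 ≤ functionalNorm (e' n) :=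
      Real.sSup_nonneg (by rintro _ ⟨x, -, rfl⟩; exact norm_nonneg _)
    rw [inv_le_iff_one_le_mul₀ hc]
    exact h1.trans (mul_le_mul_of_nonneg_left (he n) h2)
  · refine csSup_le ⟨_, 0, by simp [hX.norm_zero], rfl⟩ ?_
    rintro _ ⟨x, hx, rfl⟩
    exact (he' n x).trans (mul_le_of_le_one_right hc.le hx)

variable {𝕜 : Type v} [RCLike 𝕜]

/-- A pointwise bounded family of functions on the finitely supported sequences, each subadditive
and homogeneous of degree `r`, which is invariant under permutations and changes of signs, gives
rise to a symmetric basis. -/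
theorem exists_symmetricBasis {r : ℝ} (hr : 0 < r) (hr1 : r ≤ 1) {ι : Type*} [Nonempty ι]
    (q : ι → (ℕ →₀ 𝕜) → ℝ) (hadd : ∀ i a b, q i (a + b) ≤ q i a + q i b)
    (hsmul : ∀ i (c : 𝕜) a, q i (c • a) = ‖c‖ ^ r * q i a)
    {K : ℝ} (hup : ∀ i a, q i a ≤ K * ∑ n ∈ a.support, ‖a n‖ ^ r)
    {c : ℝ} (hc : 0 < c) (hlow : ∀ a n, ∃ i, c * ‖a n‖ ^ r ≤ q i a)
    (hsym : ∀ (σ : Equiv.Perm ℕ) (ε : ℕ → 𝕜), IsSign ε → ∀ i, ∃ j, ∀ a,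
      q i (Finsupp.linearCombination 𝕜 (fun n => Finsupp.single (σ n) (ε n)) a) ≤ q j a) :
    ∃ S : SymmetricBasis 𝕜, S.r = r ∧
      ∀ a, ‖Finsupp.linearCombination 𝕜 S.vec a‖ = (⨆ i, q i a) ^ (1 / r) := by
  have hbdd : ∀ a, BddAbove (Set.range fun i => q i a) := fun a => by
    refine ⟨K * ∑ n ∈ a.support, ‖a n‖ ^ r, ?_⟩
    rintro _ ⟨i, rfl⟩
    exact hup i a
  have hcoord : ∀ a n, c * ‖a n‖ ^ r ≤ ⨆ i, q i a := fun a n => by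
    obtain ⟨i, hi⟩ := hlow a n
    exact hi.trans (le_ciSup (hbdd a) i)
  have hhom : ∀ (s : 𝕜) a, ⨆ i, q i (s • a) = ‖s‖ ^ r * ⨆ i, q i a := fun s a => by
    simp only [hsmul]
    exact (Real.mul_iSup_of_nonneg (by positivity) _).symm
  let N : AddGroupNorm (ℕ →₀ 𝕜) :=
    { toFun := fun a => ⨆ i, q i a
      map_zero' := by
        have := hhom 0 0
        rwa [smul_zero, norm_zero, Real.zero_rpow hr.ne', zero_mul] at this
      add_le' := fun a b => ciSup_le fun i => (hadd i a b).trans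
        (add_le_add (le_ciSup (hbdd a) i) (le_ciSup (hbdd b) i))
      neg' := fun a => by
        have := hhom (-1) a
        rwa [neg_one_smul, norm_neg, norm_one, Real.one_rpow, one_mul] at this
      eq_zero_of_map_eq_zero' := fun a ha => by
        ext n
        have h1 := hcoord a n
        rw [ha] at h1
        have h2 : ‖a n‖ ^ r = 0 :=
          le_antisymm (by nlinarith) (by positivity)
        rwa [Real.rpow_eq_zero (norm_nonneg _) hr.ne', norm_eq_zero] at h2 }
  have hNapply : ∀ a, N a = ⨆ i, q i a := fun _ => rfl
  obtain ⟨Y, _, _, _, j, hY, hj, hdense, hext⟩ := exists_pBanach_completion hr hr1 N hhom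
  have hcoord' : ∀ n a, ‖Finsupp.lapply (R := 𝕜) n a‖ ≤ (c⁻¹) ^ (1 / r) * ‖j a‖ := fun n a => by
    have h1 : ‖a n‖ ^ r ≤ c⁻¹ * N a := by
      rw [inv_mul_eq_div, le_div_iff₀ hc, mul_comm]
      exact hcoord a n
    have h2 := Real.rpow_le_rpow (by positivity) h1 (one_div_pos.2 hr).le
    rw [← Real.rpow_mul (norm_nonneg _), mul_one_div_cancel hr.ne', Real.rpow_one,
      Real.mul_rpow (by positivity) (apply_nonneg N a), ← hj] at h2
    exact h2
  choose g hg hgb using fun n => hext (Finsupp.lapply n) _ (by positivity) (hcoord' n)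
  have hlin : ∀ a, Finsupp.linearCombination 𝕜 (fun n => j (Finsupp.single n 1)) a = j a := by
    intro a
    have h1 := (Finsupp.apply_linearCombination 𝕜 j (fun n => Finsupp.single n (1 : 𝕜)) a).symm
    rw [Finsupp.linearCombination_apply, Finsupp.linearCombination_apply] at h1
    rw [Finsupp.linearCombination_apply]
    refine h1.trans ?_
    simp
  have hvec : ∀ n, ‖j (Finsupp.single n (1 : 𝕜))‖ ≤ |K| ^ (1 / r) := fun n => by
    rw [hj]
    refine Real.rpow_le_rpow (apply_nonneg N _) ?_ (one_div_pos.2 hr).le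
    refine ciSup_le fun i => (hup i _).trans ?_
    rw [Finsupp.support_single _ one_ne_zero]
    simpa using le_abs_self K
  have hbasis : IsBasis (fun n => j (Finsupp.single n (1 : 𝕜))) g := by
    refine IsBasis.of_bounds (c := |K| ^ (1 / r) + (c⁻¹) ^ (1 / r)) hY (fun y η hη => ?_)
      (fun m k => ?_) (by positivity) (fun n => ?_) (fun n y => ?_)
    · obtain ⟨a, ha⟩ := hdense y η hη
      refine ⟨j a, ?_, ha⟩
      rw [← hlin, ← Finsupp.range_linearCombination]
      exact ⟨a, rfl⟩
    · rw [hg, Finsupp.lapply_apply, Finsupp.single_apply]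
      simp only [eq_comm]
    · have : 0 ≤ (c⁻¹) ^ (1 / r) := by positivity
      linarith [hvec n]
    · refine (hgb n y).trans (mul_le_mul_of_nonneg_right ?_ (hY.nonneg y))
      linarith [Real.rpow_nonneg (abs_nonneg K) (1 / r)]
  refine ⟨SymmetricBasis.mk Y r hY _ g hbasis ⟨1, one_pos, fun σ ε hε a => ?_⟩, rfl,
    fun a => by rw [hlin, hj, hNapply]⟩
  have h1 : ∑ n ∈ a.support, (ε n * a n) • j (Finsupp.single (σ n) (1 : 𝕜))
      = j (Finsupp.linearCombination 𝕜 (fun n => Finsupp.single (σ n) (ε n)) a) := by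
    rw [Finsupp.linearCombination_apply, Finsupp.sum, map_sum]
    refine Finset.sum_congr rfl fun n _ => ?_
    rw [← map_smul, Finsupp.smul_single, Finsupp.smul_single, smul_eq_mul, smul_eq_mul, mul_one,
      mul_comm]
  rw [one_mul, hlin, h1, hj, hj]
  refine Real.rpow_le_rpow (apply_nonneg N _) ?_ (one_div_pos.2 hr).le
  refine ciSup_le fun i => ?_
  obtain ⟨k, hk⟩ := hsym σ ε hε i
  exact (hk a).trans (le_ciSup (hbdd a) k)

end Construction

/-! ### The signed fundamental function and the dominating symmetric basis. -/

section FundamentalFunction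

variable {p : ℝ} {𝕜 : Type v} {X : Type u} [RCLike 𝕜] [AddCommGroup X] [Module 𝕜 X] [Norm X]
  {e : ℕ → X} {e' : ℕ → (X →ₗ[𝕜] 𝕜)}

variable (p 𝕜) in
/-- The `p`-th power of the fundamental function, with signs:
`sup {‖1_{ε, A}‖ ^ p : |A| ≤ m}`. -/
noncomputable def signedFundamental (e : ℕ → X) (m : ℕ) : ℝ :=
  sSup {t : ℝ | ∃ (A : Finset ℕ) (ε : ℕ → 𝕜), A.card ≤ m ∧ IsSign ε ∧
    t = ‖signedIndicator e ε A‖ ^ p}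

theorem le_signedFundamental (hX : IsPBanach p 𝕜 X) (hB : IsBasis e e') {A : Finset ℕ}
    {ε : ℕ → 𝕜} {m : ℕ} (hA : A.card ≤ m) (hε : IsSign ε) :
    ‖signedIndicator e ε A‖ ^ p ≤ signedFundamental p 𝕜 e m := by
  obtain ⟨c, hc, hce, -⟩ := hB.exists_bound hX
  refine le_csSup ⟨m * c ^ p, ?_⟩ ⟨A, ε, hA, hε, rfl⟩
  rintro _ ⟨A, ε, hA, hε, rfl⟩
  refine (norm_signedIndicator_rpow_le hX hce hε A).trans ?_
  gcongr

theorem signedFundamental_le {m : ℕ} {s : ℝ}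
    (h : ∀ (A : Finset ℕ) (ε : ℕ → 𝕜), A.card ≤ m → IsSign ε → ‖signedIndicator e ε A‖ ^ p ≤ s) :
    signedFundamental p 𝕜 e m ≤ s := by
  refine csSup_le ⟨_, ∅, fun _ => 1, by simp, fun _ => norm_one, rfl⟩ ?_
  rintro _ ⟨A, ε, hA, hε, rfl⟩
  exact h A ε hA hε

theorem signedFundamental_mono (hX : IsPBanach p 𝕜 X) (hB : IsBasis e e') :
    Monotone (signedFundamental p 𝕜 e) := fun _ _ hmn =>
  signedFundamental_le fun _ _ hA hε => le_signedFundamental hX hB (hA.trans hmn) hε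

theorem signedFundamental_nonneg (hX : IsPBanach p 𝕜 X) (m : ℕ) :
    0 ≤ signedFundamental p 𝕜 e m :=
  Real.sSup_nonneg (by
    rintro _ ⟨A, ε, -, -, rfl⟩
    exact Real.rpow_nonneg (hX.nonneg _) p)

theorem signedFundamental_zero (hX : IsPBanach p 𝕜 X) : signedFundamental p 𝕜 e 0 = 0 := by
  refine le_antisymm (signedFundamental_le fun A ε hA _ => ?_) (signedFundamental_nonneg hX 0)
  obtain rfl := Finset.card_eq_zero.1 (Nat.le_zero.1 hA)
  rw [signedIndicator, Finset.sum_empty, hX.norm_zero, Real.zero_rpow hX.p_pos.ne']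

theorem signedFundamental_pos (hX : IsPBanach p 𝕜 X) (hB : IsBasis e e') {m : ℕ} (hm : 1 ≤ m) :
    0 < signedFundamental p 𝕜 e m := by
  refine lt_of_lt_of_le ?_ (le_signedFundamental hX hB (A := {0}) (ε := fun _ => 1) (by simpa)
    fun _ => norm_one)
  obtain ⟨c₁, c₂, hc, H⟩ := hB.seminormalized
  have := hc.trans_le (H 0).1
  simp only [signedIndicator, Finset.sum_singleton, one_smul]
  positivity

theorem signedFundamental_add_le (hX : IsPBanach p 𝕜 X) (hB : IsBasis e e') (m k : ℕ) :
    signedFundamental p 𝕜 e (m + k)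
      ≤ signedFundamental p 𝕜 e m + signedFundamental p 𝕜 e k := by
  classical
  refine signedFundamental_le fun A ε hA hε => ?_
  obtain ⟨A₁, hA₁, hcard⟩ := Finset.exists_subset_card_eq (min_le_right m A.card)
  have h1 : signedIndicator e ε A = signedIndicator e ε A₁ + signedIndicator e ε (A \ A₁) := by
    rw [add_comm]
    exact (Finset.sum_sdiff hA₁).symm
  rw [h1]
  refine (hX.add_rpow_le _ _).trans (add_le_add
    (le_signedFundamental hX hB (by omega) hε) (le_signedFundamental hX hB ?_ hε))
  rw [Finset.card_sdiff_of_subset hA₁]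
  omega

theorem signedFundamental_mul_le (hX : IsPBanach p 𝕜 X) (hB : IsBasis e e') (k m : ℕ) :
    signedFundamental p 𝕜 e (k * m) ≤ k * signedFundamental p 𝕜 e m := by
  induction k with
  | zero => simp [signedFundamental_zero hX]
  | succ k ih =>
    rw [Nat.succ_mul]
    refine (signedFundamental_add_le hX hB _ _).trans ?_
    push_cast
    linarith

/-- A set of size k is covered by ⌊k/m⌋ + 1 blocks of size m, and m(⌊k/m⌋ + 1) ≤ k + m ≤ 2k. So
W(k)/k is decreasing up to the factor 2, where W is the signed fundamental function. -/
theorem mul_signedFundamental_le (hX : IsPBanach p 𝕜 X) (hB : IsBasis e e') {m k : ℕ}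
    (hm : 1 ≤ m) (hmk : m ≤ k) :
    m * signedFundamental p 𝕜 e k ≤ 2 * k * signedFundamental p 𝕜 e m := by
  have h1 : k ≤ (k / m + 1) * m := (Nat.lt_div_mul_add hm).le.trans_eq (by ring)
  have h2 := (signedFundamental_mono hX hB h1).trans (signedFundamental_mul_le hX hB _ m)
  have h3 : m * (k / m + 1) ≤ 2 * k := by
    have := Nat.mul_div_le k m
    rw [mul_add]
    omega
  have h4 : (m : ℝ) * ((k / m + 1 : ℕ) : ℝ) ≤ 2 * k := by exact_mod_cast h3
  have h5 := signedFundamental_nonneg (𝕜 := 𝕜) (e := e) hX m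
  calc m * signedFundamental p 𝕜 e k
      ≤ m * (((k / m + 1 : ℕ) : ℝ) * signedFundamental p 𝕜 e m) := by gcongr
    _ = (m * ((k / m + 1 : ℕ) : ℝ)) * signedFundamental p 𝕜 e m := by ring
    _ ≤ _ := by gcongr

theorem indicatorVec_eq_linearCombination (𝕜 : Type v) [RCLike 𝕜] {X : Type u} [AddCommGroup X]
    [Module 𝕜 X] (e : ℕ → X) (A : Finset ℕ) :
    indicatorVec e A = Finsupp.linearCombination 𝕜 e (∑ n ∈ A, Finsupp.single n 1) := by
  rw [linearCombination_eq_signedIndicator e (fun _ => (1 : 𝕜)), signedIndicator_one]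

/-- Taking the supremum over all permutations and changes of signs yields a symmetric basis
which dominates the given one. -/
theorem exists_dominating_symmetricBasis (hX : IsPBanach p 𝕜 X) (hB : IsBasis e e') :
    ∃ S : SymmetricBasis 𝕜, Dominates 𝕜 S.vec e ∧
      ∀ m, fundamentalFunction S.vec m = signedFundamental p 𝕜 e m ^ (1 / p) := by
  classical
  obtain ⟨c, hc, hce, hcoord⟩ := hB.exists_bound hX
  have hp := hX.p_pos
  let q : Equiv.Perm ℕ × {ε : ℕ → 𝕜 // IsSign ε} → (ℕ →₀ 𝕜) → ℝ := fun i a =>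
    ‖Finsupp.linearCombination 𝕜 (fun n => i.2.1 n • e (i.1 n)) a‖ ^ p
  have one_sign : IsSign (fun _ : ℕ => (1 : 𝕜)) := fun _ => norm_one
  have : Nonempty (Equiv.Perm ℕ × {ε : ℕ → 𝕜 // IsSign ε}) := ⟨(1, ⟨_, one_sign⟩)⟩
  have hq1 : ∀ a, q (1, ⟨_, one_sign⟩) a = ‖Finsupp.linearCombination 𝕜 e a‖ ^ p := fun a => by
    simp [q]
  have hup : ∀ i a, q i a ≤ c ^ p * ∑ n ∈ a.support, ‖a n‖ ^ p := by
    intro i a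
    simp only [q]
    rw [Finsupp.linearCombination_apply, Finsupp.sum, Finset.mul_sum]
    refine (hX.sum_rpow_le _ _).trans (Finset.sum_le_sum fun n _ => ?_)
    rw [hX.smul_rpow, hX.smul, i.2.2 n, one_mul, mul_comm]
    gcongr
    · exact hX.nonneg _
    · exact hce _
  obtain ⟨S, -, hS⟩ := exists_symmetricBasis hp hX.p_le_one q
    (fun i a b => by simpa only [q, map_add] using hX.add_rpow_le _ _)
    (fun i s a => by simpa only [q, map_smul] using hX.smul_rpow _ _) hup
    (c := (c⁻¹) ^ p) (by positivity)
    (fun a n => ⟨(1, ⟨_, one_sign⟩), by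
      rw [hq1, ← Real.mul_rpow (by positivity) (norm_nonneg _)]
      refine Real.rpow_le_rpow (by positivity) ?_ hp.le
      rw [inv_mul_le_iff₀ hc, ← hB.coord_linearCombination a n]
      exact hcoord n _⟩)
    (fun σ ε hε i => ⟨(i.1 * σ, ⟨fun n => ε n * i.2.1 (σ n), fun n => by
      rw [norm_mul, hε n, i.2.2 (σ n), one_mul]⟩), fun a => le_of_eq (by
        simp only [q]
        congr 2
        rw [Finsupp.apply_linearCombination]
        congr 2
        funext n
        simp [mul_smul])⟩)
  have hbdd : ∀ a, BddAbove (Set.range fun i => q i a) := fun a => by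
    refine ⟨c ^ p * ∑ n ∈ a.support, ‖a n‖ ^ p, ?_⟩
    rintro _ ⟨i, rfl⟩
    exact hup i a
  have hqS : ∀ i a, q i a ^ (1 / p) ≤ ‖Finsupp.linearCombination 𝕜 S.vec a‖ := fun i a => by
    rw [hS]
    exact Real.rpow_le_rpow (Real.rpow_nonneg (hX.nonneg _) _) (le_ciSup (hbdd a) i)
      (one_div_pos.2 hp).le
  -- Each index turns an unsigned indicator into a signed one on a permuted set, so the fundamental
  -- function of `S`, defined without signs, already sees all signs of e.
  have hqind : ∀ i (A : Finset ℕ), q i (∑ n ∈ A, Finsupp.single n 1)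
      = ‖signedIndicator e (fun n => i.2.1 (i.1.symm n)) (A.map i.1.toEmbedding)‖ ^ p := by
    intro i A
    simp only [q]
    rw [← indicatorVec_eq_linearCombination]
    simp [indicatorVec, signedIndicator]
  refine ⟨S, ⟨1, one_pos, fun a => ?_⟩, fun m => ?_⟩
  · have h1 := hqS (1, ⟨_, one_sign⟩) a
    rwa [hq1, ← Real.rpow_mul (hX.nonneg _), mul_one_div_cancel hp.ne', Real.rpow_one,
      ← one_mul ‖Finsupp.linearCombination 𝕜 S.vec a‖] at h1
  · have hind : ∀ A : Finset ℕ, A.card ≤ m →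
        ‖indicatorVec S.vec A‖ ≤ signedFundamental p 𝕜 e m ^ (1 / p) := by
      intro A hA
      rw [indicatorVec_eq_linearCombination 𝕜, hS]
      refine Real.rpow_le_rpow (Real.iSup_nonneg fun i => Real.rpow_nonneg (hX.nonneg _) _)
        (ciSup_le fun i => ?_) (one_div_pos.2 hp).le
      rw [hqind]
      exact le_signedFundamental hX hB (by rwa [Finset.card_map]) fun n => i.2.2 _
    refine le_antisymm (csSup_le ⟨_, ∅, by simp, rfl⟩ ?_) ?_
    · rintro _ ⟨A, hA, rfl⟩
      exact hind A hA
    · have hF : ∀ A : Finset ℕ, A.card ≤ m →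
          ‖indicatorVec S.vec A‖ ≤ fundamentalFunction S.vec m := fun A hA =>
        le_csSup ⟨signedFundamental p 𝕜 e m ^ (1 / p), by
          rintro _ ⟨A, hA, rfl⟩
          exact hind A hA⟩ ⟨A, hA, rfl⟩
      have hF0 : 0 ≤ fundamentalFunction S.vec m :=
        (S.isPBanach.nonneg _).trans (hF ∅ (by simp))
      refine (Real.rpow_le_rpow (signedFundamental_nonneg hX m)
        (signedFundamental_le (s := fundamentalFunction S.vec m ^ p) fun A ε hA hε => ?_)
        (one_div_pos.2 hp).le).trans_eq ?_
      · refine Real.rpow_le_rpow (hX.nonneg _) (le_trans ?_ (hF A hA)) hp.le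
        rw [indicatorVec_eq_linearCombination 𝕜]
        have h1 := hqS (1, ⟨ε, hε⟩) (∑ n ∈ A, Finsupp.single n 1)
        rw [hqind, ← Real.rpow_mul (hX.nonneg _), mul_one_div_cancel hp.ne', Real.rpow_one] at h1
        refine le_trans (le_of_eq ?_) h1
        simp only [signedIndicator, Finset.sum_map]
        rfl
      · rw [← Real.rpow_mul hF0, mul_one_div_cancel hp.ne', Real.rpow_one]

end FundamentalFunction

/-! ### The dominated Lorentz-type basis. -/

section Dominated

variable {p : ℝ} {𝕜 : Type v} {X : Type u} [RCLike 𝕜] [AddCommGroup X] [Module 𝕜 X] [Norm X]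
  {e : ℕ → X} {e' : ℕ → (X →ₗ[𝕜] 𝕜)}

/-- A weak-type bound on the size of the coefficients implies a strong bound for exponents at
which the weight is summable. -/
theorem sum_le_of_weak_bound {s b : ℕ → ℝ} {k : ℕ} {V : ℝ} (hV : 0 ≤ V) (hb : ∀ n, 0 ≤ b n)
    (hs : ∀ m, 1 ≤ m → m ≤ k → √m * s k ≤ √(2 * k) * s m)
    (hweak : ∀ (D : Finset ℕ) (t : ℝ), 0 ≤ t → (∀ n ∈ D, t ≤ b n) → t * s D.card ≤ V)
    (A : Finset ℕ) (hA : A.card ≤ k) :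
    s k * ∑ n ∈ A, b n ≤ V * √(2 * k) * (2 * √A.card) := by
  classical
  induction hj : A.card generalizing A with
  | zero =>
    obtain rfl := Finset.card_eq_zero.1 hj
    simp
  | succ j ih =>
    -- The weak bound at the level of the smallest term on A controls that term by a multiple of
    -- 1/√|A|; removing it and iterating sums 1/√i, which is at most 2√|A|.
    obtain ⟨n₀, hn₀, hmin⟩ := A.exists_min_image b (Finset.card_pos.1 (by omega))
    have hcard : (A.erase n₀).card = j := by rw [Finset.card_erase_of_mem hn₀, hj]; rfl
    have h1 := ih (A.erase n₀) (by omega) hcard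
    have h2 := hweak A (b n₀) (hb n₀) hmin
    have h3 := hs (j + 1) (by omega) (by omega)
    rw [hj] at h2
    rw [← Finset.add_sum_erase _ _ hn₀, mul_add]
    have hpos : 0 < √((j + 1 : ℕ) : ℝ) := Real.sqrt_pos.2 (by positivity)
    have h4 : s k * b n₀ ≤ V * √(2 * k) / √((j + 1 : ℕ) : ℝ) := by
      rw [le_div_iff₀ hpos]
      calc s k * b n₀ * √((j + 1 : ℕ) : ℝ) = b n₀ * (√((j + 1 : ℕ) : ℝ) * s k) := by ring
        _ ≤ b n₀ * (√(2 * k) * s (j + 1)) := mul_le_mul_of_nonneg_left h3 (hb n₀)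
        _ = √(2 * k) * (b n₀ * s (j + 1)) := by ring
        _ ≤ √(2 * k) * V := mul_le_mul_of_nonneg_left h2 (Real.sqrt_nonneg _)
        _ = _ := mul_comm _ _
    have h5 : 1 / √((j + 1 : ℕ) : ℝ) + 2 * √(j : ℝ) ≤ 2 * √((j + 1 : ℕ) : ℝ) := by
      rw [← le_sub_iff_add_le, div_le_iff₀ hpos]
      have h6 := Real.sq_sqrt (Nat.cast_nonneg (α := ℝ) (j + 1))
      have h7 := Real.sq_sqrt (Nat.cast_nonneg (α := ℝ) j)
      push_cast at h6 ⊢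
      nlinarith [sq_nonneg (√((j : ℝ) + 1) - √(j : ℝ))]
    have h8 : 0 ≤ V * √(2 * k) := by positivity
    calc s k * b n₀ + s k * ∑ n ∈ A.erase n₀, b n
        ≤ V * √(2 * k) / √((j + 1 : ℕ) : ℝ) + V * √(2 * k) * (2 * √(j : ℝ)) := add_le_add h4 h1
      _ = V * √(2 * k) * (1 / √((j + 1 : ℕ) : ℝ) + 2 * √(j : ℝ)) := by ring
      _ ≤ _ := mul_le_mul_of_nonneg_left h5 h8

theorem LargeCoefficientEstimate.exists_weak_bound (hX : IsPBanach p 𝕜 X)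
    (h : LargeCoefficientEstimate 𝕜 e) :
    ∃ K : ℝ, 0 < K ∧ ∀ (a : ℕ →₀ 𝕜) (D : Finset ℕ) (t : ℝ), 0 ≤ t →
      (∀ n ∈ D, t ≤ ‖a n‖ ^ (p / 2)) → t * √(signedFundamental p 𝕜 e D.card)
        ≤ (K * ‖Finsupp.linearCombination 𝕜 e a‖) ^ (p / 2) := by
  obtain ⟨K, hK, H⟩ := h
  have hp := hX.p_pos
  refine ⟨K, hK, fun a D t ht hD => ?_⟩
  have hV0 : 0 ≤ K * ‖Finsupp.linearCombination 𝕜 e a‖ := mul_nonneg hK.le (hX.nonneg _)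
  rcases ht.eq_or_lt with rfl | ht
  · rw [zero_mul]
    positivity
  set V := K * ‖Finsupp.linearCombination 𝕜 e a‖ with hV
  set τ := t ^ (2 / p) with hτ
  have hτ0 : 0 < τ := by positivity
  -- The level t for |a_n|^(p/2) is the level τ for |a_n|. The large coefficient estimate then
  -- bounds t² W(|D|), and a square root is taken at the end.
  have hτp : τ ^ p = t ^ 2 := by
    rw [hτ, ← Real.rpow_mul ht.le, div_mul_cancel₀ _ hp.ne', Real.rpow_two]
  have hτD : ∀ n ∈ D, τ ≤ ‖a n‖ := fun n hn => by
    have h1 := Real.rpow_le_rpow ht.le (hD n hn) (show 0 ≤ 2 / p by positivity)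
    rwa [← Real.rpow_mul (norm_nonneg _), show p / 2 * (2 / p) = 1 by field_simp,
      Real.rpow_one] at h1
  have h1 : signedFundamental p 𝕜 e D.card ≤ V ^ p / t ^ 2 := by
    refine signedFundamental_le fun A ε hA hε => ?_
    have h2 := Real.rpow_le_rpow (mul_nonneg hτ0.le (hX.nonneg _)) (H a D A τ hτ0 hτD hA ε hε) hp.le
    rw [Real.mul_rpow hτ0.le (hX.nonneg _), hτp] at h2
    rwa [le_div_iff₀ (by positivity), mul_comm]
  rw [le_div_iff₀ (by positivity)] at h1
  have h3 : V ^ p = (V ^ (p / 2)) ^ 2 := by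
    rw [← Real.rpow_natCast, ← Real.rpow_mul hV0]
    congr 1
    push_cast
    ring
  refine le_of_sq_le_sq ?_ (by positivity)
  rw [mul_pow, Real.sq_sqrt (signedFundamental_nonneg hX _), ← h3]
  linarith

/-- A basis satisfying the large coefficient estimate dominates a symmetric basis of a weighted
Lorentz-type space with an equivalent fundamental function. -/
theorem LargeCoefficientEstimate.exists_dominated_symmetricBasis (hX : IsPBanach p 𝕜 X)
    (hB : IsBasis e e') (h : LargeCoefficientEstimate 𝕜 e) :
    ∃ T : SymmetricBasis 𝕜, Dominates 𝕜 e T.vec ∧ ∀ m,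
      signedFundamental p 𝕜 e m ^ (1 / p) ≤ fundamentalFunction T.vec m ∧
      fundamentalFunction T.vec m ≤ (2 * signedFundamental p 𝕜 e m) ^ (1 / p) := by
  classical
  have hp := hX.p_pos
  have hp1 := hX.p_le_one
  set W := signedFundamental p 𝕜 e with hW
  have hW0 : ∀ m, 0 ≤ W m := signedFundamental_nonneg hX
  have hWmono : Monotone W := signedFundamental_mono hX hB
  have hr : 0 < p / 2 := by positivity
  -- Halving the exponent replaces the weight W by √W, whose growth of order at most √k makes the
  -- weak bound summable. The resulting space is p/2-normed.
  let q : {A : Finset ℕ // A.Nonempty} → (ℕ →₀ 𝕜) → ℝ := fun A a =>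
    √(W A.1.card) / A.1.card * ∑ n ∈ A.1, ‖a n‖ ^ (p / 2)
  have : Nonempty {A : Finset ℕ // A.Nonempty} := ⟨⟨{0}, by simp⟩⟩
  have hq0 : ∀ A a, 0 ≤ q A a := fun A a =>
    mul_nonneg (by positivity) (Finset.sum_nonneg fun n _ => by positivity)
  have hup : ∀ A a, q A a ≤ √(W 1) * ∑ n ∈ a.support, ‖a n‖ ^ (p / 2) := by
    intro A a
    have hA : 1 ≤ A.1.card := A.2.card_pos
    have hA' : (1 : ℝ) ≤ A.1.card := by exact_mod_cast hA
    have h1 : √(W A.1.card) / A.1.card ≤ √(W 1) := by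
      rw [div_le_iff₀ (by positivity)]
      have h2 := signedFundamental_mul_le (𝕜 := 𝕜) hX hB A.1.card 1
      rw [mul_one] at h2
      refine (Real.sqrt_le_sqrt h2).trans ?_
      rw [Real.sqrt_mul (by positivity), mul_comm]
      refine mul_le_mul_of_nonneg_left ?_ (Real.sqrt_nonneg _)
      rw [Real.sqrt_le_left (by positivity)]
      nlinarith
    refine mul_le_mul h1 ?_ (Finset.sum_nonneg fun n _ => by positivity) (Real.sqrt_nonneg _)
    rw [← Finset.sum_filter_ne_zero]
    refine Finset.sum_le_sum_of_subset_of_nonneg (fun n hn => ?_) fun n _ _ => by positivity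
    have hn := (Finset.mem_filter.1 hn).2
    rw [Finsupp.mem_support_iff]
    rintro h0
    rw [h0, norm_zero, Real.zero_rpow hr.ne'] at hn
    exact hn rfl
  obtain ⟨T, -, hT⟩ := exists_symmetricBasis hr (by linarith) q
    (fun A a b => by
      simp only [q]
      rw [← mul_add, ← Finset.sum_add_distrib]
      refine mul_le_mul_of_nonneg_left (Finset.sum_le_sum fun n _ => ?_) (by positivity)
      rw [Finsupp.add_apply]
      exact (Real.rpow_le_rpow (norm_nonneg _) (norm_add_le _ _) hr.le).trans
        (Real.rpow_add_le_add_rpow (norm_nonneg _) (norm_nonneg _) hr.le (by linarith)))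
    (fun A s a => by
      simp only [q]
      rw [Finset.mul_sum, Finset.mul_sum, Finset.mul_sum]
      refine Finset.sum_congr rfl fun n _ => ?_
      rw [Finsupp.smul_apply, smul_eq_mul, norm_mul,
        Real.mul_rpow (norm_nonneg _) (norm_nonneg _)]
      ring)
    hup (c := √(W 1)) (Real.sqrt_pos.2 (signedFundamental_pos hX hB le_rfl))
    (fun a n => ⟨⟨{n}, by simp⟩, by simp [q]⟩)
    (fun σ ε hε A => ⟨⟨A.1.map σ.symm.toEmbedding, by simpa using A.2⟩, fun a => le_of_eq (by
      simp only [q, Finset.card_map, Finset.sum_map]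
      congr 1
      refine Finset.sum_congr rfl fun n _ => ?_
      congr 1
      have h1 : Finsupp.linearCombination 𝕜 (fun n => Finsupp.single (σ n) (ε n)) a n
          = a (σ.symm n) * ε (σ.symm n) := by
        rw [Finsupp.linearCombination_apply, Finsupp.sum, Finsupp.finsetSum_apply]
        simp only [Finsupp.smul_single, smul_eq_mul, Finsupp.single_apply]
        rw [Finset.sum_eq_single (σ.symm n)]
        · simp
        · intro k _ hk
          rw [if_neg]
          rintro rfl
          simp at hk
        · intro hk
          simp [Finsupp.notMem_support_iff.1 hk]
      rw [h1, norm_mul, hε, mul_one]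
      rfl)⟩)
  have hbdd : ∀ a, BddAbove (Set.range fun A => q A a) := fun a => by
    refine ⟨√(W 1) * ∑ n ∈ a.support, ‖a n‖ ^ (p / 2), ?_⟩
    rintro _ ⟨i, rfl⟩
    exact hup i a
  have hexp : ∀ s : ℝ, 0 ≤ s → √s ^ (1 / (p / 2)) = s ^ (1 / p) := fun s hs => by
    rw [Real.sqrt_eq_rpow, ← Real.rpow_mul hs]
    congr 1
    field_simp
  -- On 1_B the choice A = B gives exactly √W(|B|), and near-monotonicity of W(k)/k prevents any
  -- other A from exceeding √(2W(|B|)).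
  have hqind : ∀ (A : {A : Finset ℕ // A.Nonempty}) (B : Finset ℕ),
      q A (∑ n ∈ B, Finsupp.single n 1) = √(W A.1.card) / A.1.card * (A.1 ∩ B).card := by
    intro A B
    simp only [q]
    congr 1
    rw [Finset.card_eq_sum_ones, Nat.cast_sum, ← Finset.filter_mem_eq_inter, Finset.sum_filter]
    refine Finset.sum_congr rfl fun n _ => ?_
    rw [sum_single_apply (fun _ => (1 : 𝕜))]
    split_ifs
    · simp
    · simp [Real.zero_rpow hr.ne']
  have hindle : ∀ (m : ℕ) (B : Finset ℕ), B.card ≤ m →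
      ‖indicatorVec T.vec B‖ ≤ (2 * W m) ^ (1 / p) := by
    intro m B hBm
    rw [indicatorVec_eq_linearCombination 𝕜, hT, ← hexp _ (mul_nonneg zero_le_two (hW0 m))]
    refine Real.rpow_le_rpow (Real.iSup_nonneg fun A => hq0 A _) (ciSup_le fun A => ?_)
      (one_div_pos.2 hr).le
    rw [hqind]
    have hA : 1 ≤ A.1.card := A.2.card_pos
    have hA' : (0 : ℝ) < A.1.card := by exact_mod_cast hA
    have h1 : ((A.1 ∩ B).card : ℝ) ≤ A.1.card := by
      exact_mod_cast Finset.card_le_card Finset.inter_subset_left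
    have h2 : (A.1 ∩ B).card ≤ m := (Finset.card_le_card Finset.inter_subset_right).trans hBm
    rcases Nat.eq_zero_or_pos (A.1 ∩ B).card with h0 | h0
    · rw [h0, Nat.cast_zero, mul_zero]
      positivity
    · refine Real.le_sqrt_of_sq_le ?_
      have h3 := mul_signedFundamental_le (𝕜 := 𝕜) hX hB h0
        (Finset.card_le_card (Finset.inter_subset_left (s₁ := A.1) (s₂ := B)))
      have h4 := hWmono h2
      rw [mul_pow, div_pow, Real.sq_sqrt (hW0 _), div_mul_eq_mul_div, div_le_iff₀ (by positivity)]
      have h5 : (0 : ℝ) ≤ (A.1 ∩ B).card := by positivity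
      calc W A.1.card * ((A.1 ∩ B).card : ℝ) ^ 2
          = ((A.1 ∩ B).card * W A.1.card) * (A.1 ∩ B).card := by ring
        _ ≤ (2 * A.1.card * W (A.1 ∩ B).card) * (A.1 ∩ B).card := by gcongr
        _ ≤ (2 * A.1.card * W m) * A.1.card := by
          have := hW0 m
          gcongr
        _ = _ := by ring
  refine ⟨T, ?_, fun m => ⟨?_, csSup_le ⟨_, ∅, by simp, rfl⟩ ?_⟩⟩
  · obtain ⟨K, hK, hweak⟩ := h.exists_weak_bound hX
    -- With k = |A|, the strong bound contributes √(2k) · 2√k / k = 2√2 before the power 2/p is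
    -- taken.
    refine ⟨(2 * √2) ^ (1 / (p / 2)) * K, by positivity, fun a => ?_⟩
    set V := K * ‖Finsupp.linearCombination 𝕜 e a‖ with hV
    have hV0 : 0 ≤ V := mul_nonneg hK.le (hX.nonneg _)
    have h1 : ⨆ A, q A a ≤ 2 * √2 * V ^ (p / 2) := by
      refine ciSup_le fun A => ?_
      have hA : 1 ≤ A.1.card := A.2.card_pos
      have hA' : (0 : ℝ) < A.1.card := by exact_mod_cast hA
      have h2 := sum_le_of_weak_bound (s := fun m => √(W m)) (b := fun n => ‖a n‖ ^ (p / 2))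
        (k := A.1.card) (V := V ^ (p / 2)) (by positivity) (fun n => by positivity)
        (fun m hm hmk => by
          rw [← Real.sqrt_mul (by positivity), ← Real.sqrt_mul (by positivity)]
          exact Real.sqrt_le_sqrt (mul_signedFundamental_le hX hB hm hmk))
        (fun D t ht hD => hweak a D t ht hD) A.1 le_rfl
      simp only [q]
      rw [div_mul_eq_mul_div, div_le_iff₀ hA']
      refine h2.trans_eq ?_
      rw [Real.sqrt_mul (by positivity)]
      calc V ^ (p / 2) * (√2 * √A.1.card) * (2 * √A.1.card)
          = 2 * √2 * V ^ (p / 2) * (√A.1.card * √A.1.card) := by ring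
        _ = _ := by rw [Real.mul_self_sqrt hA'.le]
    rw [hT, mul_assoc, ← hV]
    refine (Real.rpow_le_rpow (Real.iSup_nonneg fun A => hq0 A _) h1
      (one_div_pos.2 hr).le).trans_eq ?_
    rw [Real.mul_rpow (by positivity) (by positivity), ← Real.rpow_mul hV0,
      mul_one_div_cancel hr.ne', Real.rpow_one]
  · have hF : ∀ B : Finset ℕ, B.card ≤ m →
        ‖indicatorVec T.vec B‖ ≤ fundamentalFunction T.vec m := fun B hBm =>
      le_csSup ⟨(2 * W m) ^ (1 / p), by
        rintro _ ⟨B, hBm, rfl⟩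
        exact hindle m B hBm⟩ ⟨B, hBm, rfl⟩
    -- The functionals are indexed by nonempty sets, so m = 0 cannot be tested on `Finset.range m`.
    rcases Nat.eq_zero_or_pos m with rfl | hm
    · rw [hW, signedFundamental_zero hX, Real.zero_rpow (one_div_pos.2 hp).ne']
      exact (T.isPBanach.nonneg _).trans (hF ∅ (by simp))
    · refine le_trans ?_ (hF (Finset.range m) (by simp))
      have hm' : (0 : ℝ) < m := by exact_mod_cast hm
      rw [indicatorVec_eq_linearCombination 𝕜, hT, ← hexp _ (hW0 m)]
      refine Real.rpow_le_rpow (Real.sqrt_nonneg _) ?_ (one_div_pos.2 hr).le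
      refine le_trans (le_of_eq ?_) (le_ciSup (hbdd _) ⟨Finset.range m, by simpa using hm.ne'⟩)
      rw [hqind]
      simp only [Finset.inter_self, Finset.card_range]
      rw [div_mul_cancel₀ _ hm'.ne']
  · rintro _ ⟨B, hBm, rfl⟩
    exact hindle m B hBm

theorem LargeCoefficientEstimate.isSqueezeSymmetric (hX : IsPBanach p 𝕜 X) (hB : IsBasis e e')
    (h : LargeCoefficientEstimate 𝕜 e) : IsSqueezeSymmetric 𝕜 e := by
  obtain ⟨S, hS, hφS⟩ := exists_dominating_symmetricBasis hX hB
  obtain ⟨T, hT, hφT⟩ := h.exists_dominated_symmetricBasis hX hB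
  refine ⟨S, T, hS, hT, 2 ^ (1 / p), by positivity, fun m => ?_⟩
  have h0 := signedFundamental_nonneg (𝕜 := 𝕜) (e := e) hX m
  have h1 : (1 : ℝ) ≤ 2 ^ (1 / p) :=
    Real.one_le_rpow one_le_two (one_div_pos.2 hX.p_pos).le
  rw [hφS]
  constructor
  · refine (hφT m).1.trans (le_mul_of_one_le_left ?_ h1)
    exact (Real.rpow_nonneg h0 _).trans (hφT m).1
  · rw [← Real.mul_rpow zero_le_two h0]
    exact (hφT m).2

end Dominated

theorem mainTheorem6 {𝕜 : Type v} {X : Type u} [RCLike 𝕜] [AddCommGroup X] [Module 𝕜 X] [Norm X]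
    (p : ℝ) (hX : IsPBanach p 𝕜 X) (e : ℕ → X) (e' : ℕ → (X →ₗ[𝕜] 𝕜)) (hB : IsBasis e e') :
    (IsSqueezeSymmetric 𝕜 e → OneDimApprox e e') ∧
    (OneDimApprox e e' → DisjointOneDimApprox e e') ∧
    ((p = 1 ∧ IsMarkushevichBasis e e') ∨ IsSchauderBasis e e' →
      DisjointOneDimApprox e e' → IsSqueezeSymmetric 𝕜 e) :=
  ⟨fun h => h.largeCoefficientEstimate.oneDimApprox hX hB, fun h => h.disjointOneDimApprox,
    fun _ h => (h.largeCoefficientEstimate hX hB).isSqueezeSymmetric hX hB⟩
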